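/- For every $n$ let $f_n:\mathbb R^n\to\mathbb R$ be a function and let $S_n=\{w\in\mathbb R^n:\ \|w\|_2=1,\ f_n(w)\le 0\}$. Let $m=m(n)$ be integers with $m<n$ for all large $n$ and $m$ proportional to $n$ (that is, $c\,n\le m\le C\,n$ for all large $n$, with constants $c,C>0$). Let $A$ be an $m\times n$ matrix and $g$ a vector in $\mathbb R^n$, both with i.i.d. standard normal entries. Put $w(f_n,g)=\sup_{w\in S_n}g^Tw$ (with value $0$ if $S_n$ is empty), $w_D(S_n)=E\,w(f_n,g)$, and $$\tau(f_n,A)=\min\{f_n(w):\ Aw=0,\ \|w\|_2=1\}.$$ Let $Y$ be a random $(n-m)$-dimensional subspace of $\mathbb R^n$ distributed uniformly in the Grassmannian with respect to the Haar measure. All infima and suprema below are taken in $[-\infty,\infty]$, and probabilities of possibly non-measurable events are outer probabilities. 1) Assume the following. (a) Except on an event of $A$'s whose probability tends to $0$ as $n\to\infty$, the minimum $\tau(f_n,A)$ is attained and minimax duality holds for it, either in the form $$\tau(f_n,A)=\inf_{\|w\|_2=1}\sup_{\nu\in\mathbb R^m}\bigl(f_n(w)+\nu^TAw\bigr)=\sup_{\nu\in\mathbb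 R^m}\inf_{\|w\|_2=1}\bigl(f_n(w)+\nu^TAw\bigr)$$ or with the three quantities replaced by their signs. (b) For every $\epsilon>0$ there is $\delta>0$, independent of $n$, such that for all large $n$ $$P\bigl(|w(f_n,g)-w_D(S_n)|\ge\epsilon\,w_D(S_n)\bigr)\le e^{-\delta\,w_D(S_n)}.$$ Let $\epsilon_1,\epsilon_2>0$ be constants. If $w_D(S_n)\ge(1+\epsilon_1)\sqrt m+\epsilon_2\sqrt n$ for all large $n$, then $$\lim_{n\to\infty}P(Y\cap S_n\ne\emptyset)=1.$$ 2) On the other hand, if $w_D(S_n)<\sqrt m-\frac1{4\sqrt m}$ for all large $n$, with a gap that diverges, $\sqrt m-\frac1{4\sqrt m}-w_D(S_n)\to\infty$, then $$\lim_{n\to\infty}P(Y\cap S_n=\emptyset)=1.$$ (Assumptions (a) and (b) are not needed here.) Both parts hold as well for the random subspace $Y=\{w:\ Aw=0\}$. -/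

import Mathlib

open Filter Topology MeasureTheory ProbabilityTheory Asymptotics
open scoped ENNReal

noncomputable section

namespace Mesh

/-- `ℝⁿ` with its Euclidean norm. -/
abbrev E (n : ℕ) : Type := EuclideanSpace ℝ (Fin n)

/-- The subset `{w : ‖w‖ = 1, f w ≤ 0}` of the unit sphere of `ℝⁿ` described by `f`. -/
def sphereSet {n : ℕ} (f : E n → ℝ) : Set (E n) := {w | ‖w‖ = 1 ∧ f w ≤ 0}

/-- `w(f, g)`, the supremum of `gᵀ w` over `w` in the set described by `f`. -/
def widthAt {n : ℕ} (f : E n → ℝ) (g : E n) : ℝ :=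
  sSup ((fun w : E n => inner ℝ g w) '' sphereSet f)

/-- The Gaussian width `E w(f, g)`, for `g` with i.i.d. standard normal coordinates. -/
def gaussianWidth {n : ℕ} (f : E n → ℝ) : ℝ := ∫ g, widthAt f g ∂(stdGaussian (E n))

/-- The law of an `m × n` matrix with i.i.d. standard normal entries. -/
def gaussianMatrix (m n : ℕ) : Measure (Fin m → Fin n → ℝ) :=
  Measure.pi fun _ => Measure.pi fun _ => gaussianReal 0 1

/-- The linear map `w ↦ A w` of a matrix given by its entries. -/
def mulMap {m n : ℕ} (A : Fin m → Fin n → ℝ) : E n →ₗ[ℝ] E m :=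
  Matrix.toEuclideanLin (Matrix.of A)

/-- The null space `{w : A w = 0}`. -/
def nullSpace {m n : ℕ} (A : Fin m → Fin n → ℝ) : Submodule ℝ (E n) := LinearMap.ker (mulMap A)

/-- The feasible set `{w : A w = 0, ‖w‖ = 1}`. -/
def feasible {m n : ℕ} (A : Fin m → Fin n → ℝ) : Set (E n) := {w | mulMap A w = 0 ∧ ‖w‖ = 1}

/-- `τ(f, A)`, the infimum of `f` over `{w : A w = 0, ‖w‖ = 1}`, as an extended real. -/
def tau {m n : ℕ} (f : E n → ℝ) (A : Fin m → Fin n → ℝ) : EReal :=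
  ⨅ w ∈ feasible A, (f w : EReal)

/-- The Lagrangian `f w + νᵀ A w`. -/
def lagrangian {m n : ℕ} (f : E n → ℝ) (A : Fin m → Fin n → ℝ) (w : E n) (ν : E m) : ℝ :=
  f w + inner ℝ ν (mulMap A w)

/-- `min_{‖w‖ = 1} max_ν (f w + νᵀ A w)`. -/
def minMax {m n : ℕ} (f : E n → ℝ) (A : Fin m → Fin n → ℝ) : EReal :=
  ⨅ w ∈ Metric.sphere (0 : E n) 1, ⨆ ν : E m, (lagrangian f A w ν : EReal)

/-- `max_ν min_{‖w‖ = 1} (f w + νᵀ A w)`. -/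
def maxMin {m n : ℕ} (f : E n → ℝ) (A : Fin m → Fin n → ℝ) : EReal :=
  ⨆ ν : E m, ⨅ w ∈ Metric.sphere (0 : E n) 1, (lagrangian f A w ν : EReal)

/-- Minimax duality for `τ(f, A)`. -/
def Duality {m n : ℕ} (f : E n → ℝ) (A : Fin m → Fin n → ℝ) : Prop :=
  tau f A = minMax f A ∧ minMax f A = maxMin f A

/-- Minimax duality for the sign of `τ(f, A)`. -/
def SignDuality {m n : ℕ} (f : E n → ℝ) (A : Fin m → Fin n → ℝ) : Prop :=
  SignType.sign (tau f A) = SignType.sign (minMax f A) ∧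
    SignType.sign (minMax f A) = SignType.sign (maxMin f A)

/-- The infimum defining `τ(f, A)` is a minimum. -/
def TauAttained {m n : ℕ} (f : E n → ℝ) (A : Fin m → Fin n → ℝ) : Prop :=
  ∃ w ∈ feasible A, ∀ v ∈ feasible A, f w ≤ f v

instance orthogonalMeasurableSpace (n : ℕ) :
    MeasurableSpace (Matrix.orthogonalGroup (Fin n) ℝ) := borel _

instance orthogonalBorelSpace (n : ℕ) : BorelSpace (Matrix.orthogonalGroup (Fin n) ℝ) := ⟨rfl⟩

instance orthogonalCompactSpace (n : ℕ) :
    CompactSpace (Matrix.orthogonalGroup (Fin n) ℝ) := by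
  refine isCompact_iff_compactSpace.mp ?_
  have hK : IsCompact (Set.pi Set.univ fun _ : Fin n => Set.pi Set.univ fun _ : Fin n =>
      Set.Icc (-1 : ℝ) 1) :=
    isCompact_univ_pi fun _ => isCompact_univ_pi fun _ => isCompact_Icc
  refine IsCompact.of_isClosed_subset hK ?_ ?_
  · have h : ((Matrix.orthogonalGroup (Fin n) ℝ : Submonoid (Matrix (Fin n) (Fin n) ℝ)) :
        Set (Matrix (Fin n) (Fin n) ℝ)) = {A | A * star A = 1} := by
      ext A
      exact Matrix.mem_unitaryGroup_iff
    rw [h]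
    exact isClosed_eq (by fun_prop) continuous_const
  · intro A hA i _ j _
    have := entry_norm_bound_of_unitary (𝕜 := ℝ) hA i j
    rw [Real.norm_eq_abs, abs_le] at this
    exact this

/-- The Haar probability measure of the orthogonal group `O(n)`. -/
def orthogonalHaar (n : ℕ) : Measure (Matrix.orthogonalGroup (Fin n) ℝ) :=
  Measure.haarMeasure ⊤

/-- The subspace of `ℝⁿ` on which the first `m` coordinates vanish; its dimension is `n - m`
when `m ≤ n`. -/
def coordSubspace (n m : ℕ) : Submodule ℝ (E n) where
  carrier := {x | ∀ i : Fin n, (i : ℕ) < m → x i = 0}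
  add_mem' := fun {a b} ha hb i hi => by simp [ha i hi, hb i hi]
  zero_mem' := fun i _ => by simp
  smul_mem' := fun c x hx i hi => by simp [hx i hi]

/-- The image of `coordSubspace n m` under an orthogonal matrix `U`. When `m ≤ n` and `U` follows
the Haar probability measure of `O(n)`, this is the random `(n - m)`-dimensional subspace that is
distributed according to the rotation-invariant (Haar) probability measure of the Grassmannian. -/
def rotatedSubspace {n : ℕ} (m : ℕ) (U : Matrix.orthogonalGroup (Fin n) ℝ) :
    Submodule ℝ (E n) :=
  (coordSubspace n m).map (Matrix.toEuclideanLin (U : Matrix (Fin n) (Fin n) ℝ))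

/-- The event that the subspace `Y` meets `S`. -/
def Meets {n : ℕ} (Y : Submodule ℝ (E n)) (S : Set (E n)) : Prop := ((Y : Set (E n)) ∩ S).Nonempty

end Mesh

end

/-! Both halves rest on one Gaussian minimax comparison. Over unit vectors, compare the process `νᵀ
A w + γ`, with `γ` an independent standard normal, to `⟨ν, h⟩ + ⟨w, g⟩`. The covariances differ by
`(1 - ⟨ν, ν'⟩) * (1 - ⟨w, w'⟩)`, which is nonnegative and vanishes when the outer vectors agree;
this is Gordon's condition. Restricting to `γ ≤ 0` costs a factor 2. Writing `σ_S` for the support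
function of `S`, the event "some `x ∈ P` has a nonpositive form against all of `Q`" is then at most
twice as likely as `σ_Q(h) - σ_P(-g) ≤ 2` (`measure_exists_forall_le`).

Escape: take `P = S` and `Q` the unit sphere of `ℝᵐ`. A null vector `w ∈ S` pairs to zero with every
`ν`, while `σ_Q(h) = ‖h‖` is near `√m` and `σ_S(-g)` is near the width, so a large gap makes this
unlikely (`measure_meets_le`).

Trapping: exchange the roles. If the null space misses `S`, then `τ > 0`, and minimax duality gives
`ν` with `νᵀ A w > 0` on `S` (`exists_dual_of_not_meets`). The existence of the direction `-ν` is
unlikely once the width exceeds `√m` by a large amount (`measure_exists_dual_le`).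

Any diverging gap suffices because the width and the norm fluctuate by `O(1)`, whatever the
dimension. For the norm this is Chebyshev's inequality; for the width it follows from Gordon's
comparison applied to two independent copies (`measure_le_abs_supportFn_sub`). Gordon's comparison
itself is a Lindeberg replacement argument for a smoothed indicator. Rotation invariance of the
Gaussian matrix transfers the bounds to the Haar subspace (`orthogonalHaar_le_gaussianMatrix`). -/

noncomputable section

namespace Mesh

/-! ### Lindeberg replacement between centered Gaussian measures. -/

section Lindeberg

variable {V : Type*} [NormedAddCommGroup V] [NormedSpace ℝ V] [MeasurableSpace V] [BorelSpace V]
  [SecondCountableTopology V] [CompleteSpace V]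

/-- A centered Gaussian measure is 2-stable. -/
lemma map_smul_add_smul_of_centered {μ : Measure V} [IsGaussian μ] (hμ : ∫ x, x ∂μ = 0)
    {a b c : ℝ} (h : a ^ 2 + b ^ 2 = c ^ 2) :
    (μ.prod μ).map (fun p : V × V => a • p.1 + b • p.2) = μ.map (fun x => c • x) := by
  have h1 : (fun p : V × V => a • p.1 + b • p.2) =
      (a • ContinuousLinearMap.fst ℝ V V + b • ContinuousLinearMap.snd ℝ V V : V × V →L[ℝ] V) := by
    ext p; simp
  have h2 : (fun x : V => c • x) = (c • ContinuousLinearMap.id ℝ V : V →L[ℝ] V) := by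
    ext p; simp
  rw [h1, h2]
  apply Measure.ext_of_charFunDual
  ext L
  have e1 : (L.comp (a • ContinuousLinearMap.fst ℝ V V + b • ContinuousLinearMap.snd ℝ V V)).comp
      (ContinuousLinearMap.inl ℝ V V) = a • L := by ext; simp
  have e2 : (L.comp (a • ContinuousLinearMap.fst ℝ V V + b • ContinuousLinearMap.snd ℝ V V)).comp
      (ContinuousLinearMap.inr ℝ V V) = b • L := by ext; simp
  have e3 : L.comp (c • ContinuousLinearMap.id ℝ V) = c • L := by ext; simp
  have hμ' : μ[id] = 0 := hμ
  have v : ∀ r : ℝ, Var[(r • L : StrongDual ℝ V); μ] = r ^ 2 * Var[L; μ] := fun r =>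
    variance_smul r L μ
  rw [charFunDual_map, charFunDual_map, charFunDual_prod, e1, e2, e3]
  simp only [IsGaussian.charFunDual_eq_of_integral_eq_zero hμ']
  rw [← Complex.exp_add]
  congr 1
  rw [v, v, v, ← h]
  push_cast
  ring

lemma integral_smul_add_smul_of_centered {μ : Measure V} [IsGaussian μ] (hμ : ∫ x, x ∂μ = 0)
    {a b c : ℝ} (h : a ^ 2 + b ^ 2 = c ^ 2) {F : V → ℝ} (hF : Continuous F)
    {K : ℝ} (hK : ∀ x, |F x| ≤ K) (z : V) :
    ∫ x, ∫ y, F (z + a • x + b • y) ∂μ ∂μ = ∫ x, F (z + c • x) ∂μ := by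
  have h1 : ∫ x, F (z + c • x) ∂μ = ∫ x, F (z + x) ∂(μ.map (fun x => c • x)) := by
    rw [integral_map (by fun_prop) (Continuous.aestronglyMeasurable (by fun_prop))]
  rw [h1, ← map_smul_add_smul_of_centered hμ h,
    integral_map (by fun_prop) (Continuous.aestronglyMeasurable (by fun_prop)), integral_prod]
  · simp only [add_assoc]
  · refine Integrable.of_bound (C := K) (Continuous.aestronglyMeasurable (by fun_prop)) ?_
    exact Eventually.of_forall fun x => hK _

/-- **Lindeberg comparison** of two centered Gaussian measures: a comparison of small
perturbations up to an error of order `δ ^ (3/2)` implies a comparison of expectations. -/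
theorem integral_le_integral_of_perturbation {μ ν : Measure V} [IsGaussian μ] [IsGaussian ν]
    (hμ : ∫ x, x ∂μ = 0) (hν : ∫ x, x ∂ν = 0) {F : V → ℝ} (hF : Continuous F)
    {K C : ℝ} (hK : ∀ x, |F x| ≤ K)
    (h : ∀ w, ∀ δ : ℝ, 0 ≤ δ →
      ∫ y, F (w + √δ • y) ∂ν ≤ ∫ x, F (w + √δ • x) ∂μ + C * (δ * √δ)) :
    ∫ y, F y ∂ν ≤ ∫ x, F x ∂μ := by
  have bdd : ∀ {α : Type _} [MeasurableSpace α] [TopologicalSpace α] [OpensMeasurableSpace α]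
      [SecondCountableTopology α] (ρ : Measure α) [IsFiniteMeasure ρ] (G : α → V),
      Continuous G → Integrable (fun a => F (G a)) ρ := by
    intro α _ _ _ _ ρ _ G hG
    exact Integrable.of_bound (C := K) (Continuous.aestronglyMeasurable (by fun_prop))
      (Eventually.of_forall fun x => hK _)
  -- Interpolation from `ν` at `s = 0` to `μ` at `s = 1`.
  let Φ : ℝ → ℝ := fun s => ∫ p, F (√s • p.1 + √(1 - s) • p.2) ∂(μ.prod ν)
  have step : ∀ s δ : ℝ, 0 ≤ s → 0 ≤ δ → s + δ ≤ 1 → Φ s ≤ Φ (s + δ) + C * (δ * √δ) := by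
    intro s δ hs hδ hsδ
    have hr : 0 ≤ 1 - (s + δ) := by linarith
    have q1 : √s ^ 2 + √δ ^ 2 = √(s + δ) ^ 2 := by
      rw [Real.sq_sqrt hs, Real.sq_sqrt hδ, Real.sq_sqrt (by positivity)]
    have q2 : √(1 - (s + δ)) ^ 2 + √δ ^ 2 = √(1 - s) ^ 2 := by
      rw [Real.sq_sqrt hr, Real.sq_sqrt hδ, Real.sq_sqrt (by linarith)]; ring
    -- By 2-stability a piece of size `√δ` splits off. Both `Φ s` and `Φ (s + δ)` become averages
    -- over the same base point `√s • x + √(1 - (s + δ)) • y`, perturbed by `√δ` times a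
    -- `ν`-variable or a `μ`-variable respectively.
    have a1 : Φ (s + δ) =
        ∫ y, ∫ x, ∫ x', F (√(1 - (s + δ)) • y + √s • x + √δ • x') ∂μ ∂μ ∂ν := by
      simp only [Φ]
      rw [integral_prod_symm _ (bdd _ _ (by fun_prop))]
      refine integral_congr_ae (Eventually.of_forall fun y => ?_)
      simp only
      rw [integral_smul_add_smul_of_centered hμ q1 hF hK]
      simp only [add_comm]
    have a2 : Φ s = ∫ x, ∫ y, ∫ y', F (√s • x + √(1 - (s + δ)) • y + √δ • y') ∂ν ∂ν ∂μ := by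
      simp only [Φ]
      rw [integral_prod _ (bdd _ _ (by fun_prop))]
      refine integral_congr_ae (Eventually.of_forall fun x => ?_)
      simp only
      rw [integral_smul_add_smul_of_centered hν q2 hF hK]
    have a3 : Φ (s + δ) =
        ∫ p, ∫ x', F (√s • p.1 + √(1 - (s + δ)) • p.2 + √δ • x') ∂μ ∂(μ.prod ν) := by
      rw [a1, integral_prod_symm]
      · refine integral_congr_ae (Eventually.of_forall fun y => ?_)
        refine integral_congr_ae (Eventually.of_forall fun x => ?_)
        simp only [add_comm]
      · exact (bdd ((μ.prod ν).prod μ)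
          (fun q => √s • q.1.1 + √(1 - (s + δ)) • q.1.2 + √δ • q.2) (by fun_prop)).integral_prod_left
    have a4 : Φ s =
        ∫ p, ∫ y', F (√s • p.1 + √(1 - (s + δ)) • p.2 + √δ • y') ∂ν ∂(μ.prod ν) := by
      rw [a2, integral_prod]
      exact (bdd ((μ.prod ν).prod ν)
          (fun q => √s • q.1.1 + √(1 - (s + δ)) • q.1.2 + √δ • q.2) (by fun_prop)).integral_prod_left
    rw [a3, a4]
    have i1 : Integrable (fun p : V × V =>
        ∫ x', F (√s • p.1 + √(1 - (s + δ)) • p.2 + √δ • x') ∂μ) (μ.prod ν) :=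
      (bdd ((μ.prod ν).prod μ)
          (fun q => √s • q.1.1 + √(1 - (s + δ)) • q.1.2 + √δ • q.2) (by fun_prop)).integral_prod_left
    have i2 : Integrable (fun p : V × V =>
        ∫ x', F (√s • p.1 + √(1 - (s + δ)) • p.2 + √δ • x') ∂ν) (μ.prod ν) :=
      (bdd ((μ.prod ν).prod ν)
          (fun q => √s • q.1.1 + √(1 - (s + δ)) • q.1.2 + √δ • q.2) (by fun_prop)).integral_prod_left
    calc _ ≤ ∫ p, (∫ x', F (√s • p.1 + √(1 - (s + δ)) • p.2 + √δ • x') ∂μ) + C * (δ * √δ)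
          ∂(μ.prod ν) :=
          integral_mono i2 (i1.add (integrable_const _)) fun p => h _ _ hδ
      _ = _ := by rw [integral_add i1 (integrable_const _)]; simp
  -- Adding up `N + 1` steps of length `1 / (N + 1)`, each with error of order `δ ^ (3/2)`, leaves a
  -- total error of order `(N + 1) ^ (-1/2)`.
  have hN : ∀ N : ℕ, Φ 0 ≤ Φ 1 + C * √(1 / ((N : ℝ) + 1)) := by
    intro N
    have hk : ∀ k : ℕ, k ≤ N + 1 → Φ 0 ≤ Φ (k / ((N : ℝ) + 1)) +
        k * (C * (1 / ((N : ℝ) + 1) * √(1 / ((N : ℝ) + 1)))) := by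
      intro k
      induction k with
      | zero => intro _; simp
      | succ k ih =>
        intro hk
        have h1 := ih (by omega)
        have h2 := step (k / ((N : ℝ) + 1)) (1 / ((N : ℝ) + 1)) (by positivity) (by positivity) (by
          rw [← add_div, div_le_one (by positivity)]; exact_mod_cast hk)
        rw [← add_div] at h2
        push_cast
        linarith
    have := hk (N + 1) le_rfl
    push_cast at this
    rw [div_self (by positivity)] at this
    calc _ ≤ _ := this
      _ = _ := by field_simp
  have hlim : Tendsto (fun N : ℕ => Φ 1 + C * √(1 / ((N : ℝ) + 1))) atTop (𝓝 (Φ 1 + C * √0)) :=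
    (((Real.continuous_sqrt.tendsto 0).comp
      tendsto_one_div_add_atTop_nhds_zero_nat).const_mul C).const_add _
  have hle : Φ 0 ≤ Φ 1 := by
    have := ge_of_tendsto' hlim hN
    simpa using this
  have e0 : Φ 0 = ∫ y, F y ∂ν := by
    simp only [Φ]
    rw [integral_prod _ (bdd _ _ (by fun_prop))]
    simp
  have e1 : Φ 1 = ∫ x, F x ∂μ := by
    simp only [Φ]
    rw [integral_prod _ (bdd _ _ (by fun_prop))]
    simp
  rwa [e0, e1] at hle

end Lindeberg

/-! ### Uniform second-order expansions, closed under products. -/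

section Jets

/-- `F` has the second-order expansion `F w + L w v + Q w v`, uniformly in `w`. -/
structure HasJet {V : Type*} [NormedAddCommGroup V] (F : V → ℝ) (L Q : V → V → ℝ) (C : ℝ) :
    Prop where
  bound : ∀ w, |F w| ≤ C
  linear_bound : ∀ w v, |L w v| ≤ C * ‖v‖
  order_zero : ∀ w v, |F (w + v) - F w| ≤ C * ‖v‖
  order_one : ∀ w v, |F (w + v) - F w - L w v| ≤ C * ‖v‖ ^ 2
  order_two : ∀ w v, |F (w + v) - F w - L w v - Q w v| ≤ C * ‖v‖ ^ 3

namespace HasJet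

variable {V : Type*} [NormedAddCommGroup V] {F G : V → ℝ} {L M Q R : V → V → ℝ} {C D : ℝ}

lemma nonneg (h : HasJet F L Q C) : 0 ≤ C := (abs_nonneg _).trans (h.bound 0)

lemma continuous (h : HasJet F L Q C) : Continuous F := by
  have : LipschitzWith C.toNNReal F := LipschitzWith.of_dist_le_mul fun x y => by
    have := h.order_zero y (x - y)
    rwa [add_sub_cancel, ← Real.dist_eq, ← dist_eq_norm, ← Real.coe_toNNReal C h.nonneg] at this
  exact this.continuous

/-- The remainder of a product regroups into products of bounds and lower-order remainders of the
factors, which is why `HasJet` also records orders zero and one. The second-order remainder has four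
such terms, hence the constant 4. -/
lemma mul (hF : HasJet F L Q C) (hG : HasJet G M R D) :
    HasJet (fun w => F w * G w) (fun w v => F w * M w v + G w * L w v)
      (fun w v => F w * R w v + G w * Q w v + L w v * M w v) (4 * C * D) := by
  have hC := hF.nonneg
  have hD := hG.nonneg
  have key : ∀ {x y X Y : ℝ}, |x| ≤ X → |y| ≤ Y → |x * y| ≤ X * Y := fun {x y X Y} hx hy => by
    rw [abs_mul]; exact mul_le_mul hx hy (abs_nonneg _) ((abs_nonneg _).trans hx)
  refine ⟨fun w => ?_, fun w v => ?_, fun w v => ?_, fun w v => ?_, fun w v => ?_⟩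
  · have := key (hF.bound w) (hG.bound w)
    nlinarith [mul_nonneg hC hD]
  · have h1 := key (hF.bound w) (hG.linear_bound w v)
    have h2 := key (hG.bound w) (hF.linear_bound w v)
    have h3 := abs_add_le (F w * M w v) (G w * L w v)
    have : 0 ≤ C * D * ‖v‖ := by positivity
    nlinarith
  · have h1 := key (hF.bound w) (hG.order_zero w v)
    have h2 := key (hG.bound (w + v)) (hF.order_zero w v)
    have h3 := abs_add_le (F w * (G (w + v) - G w)) (G (w + v) * (F (w + v) - F w))
    have : 0 ≤ C * D * ‖v‖ := by positivity
    rw [show F (w + v) * G (w + v) - F w * G w =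
      F w * (G (w + v) - G w) + G (w + v) * (F (w + v) - F w) by ring]
    nlinarith
  · have h1 := key (hF.bound w) (hG.order_one w v)
    have h2 := key (hG.bound w) (hF.order_one w v)
    have h3 := key (hF.order_zero w v) (hG.order_zero w v)
    have h4 := abs_add_three (F w * (G (w + v) - G w - M w v)) (G w * (F (w + v) - F w - L w v))
      ((F (w + v) - F w) * (G (w + v) - G w))
    have : 0 ≤ C * D * ‖v‖ ^ 2 := by positivity
    rw [show F (w + v) * G (w + v) - F w * G w - (F w * M w v + G w * L w v) =
      F w * (G (w + v) - G w - M w v) + G w * (F (w + v) - F w - L w v) +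
      (F (w + v) - F w) * (G (w + v) - G w) by ring]
    nlinarith
  · have h1 := key (hF.bound w) (hG.order_two w v)
    have h2 := key (hG.bound w) (hF.order_two w v)
    have h3 := key (hF.order_one w v) (hG.order_zero w v)
    have h4 := key (hF.linear_bound w v) (hG.order_one w v)
    have h5 := abs_add_three (F w * (G (w + v) - G w - M w v - R w v))
      (G w * (F (w + v) - F w - L w v - Q w v))
      ((F (w + v) - F w - L w v) * (G (w + v) - G w) + L w v * (G (w + v) - G w - M w v))
    have h6 := abs_add_le ((F (w + v) - F w - L w v) * (G (w + v) - G w))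
      (L w v * (G (w + v) - G w - M w v))
    have : 0 ≤ C * D * ‖v‖ ^ 3 := by positivity
    rw [show F (w + v) * G (w + v) - F w * G w - (F w * M w v + G w * L w v) -
        (F w * R w v + G w * Q w v + L w v * M w v) =
      F w * (G (w + v) - G w - M w v - R w v) + G w * (F (w + v) - F w - L w v - Q w v) +
      ((F (w + v) - F w - L w v) * (G (w + v) - G w) + L w v * (G (w + v) - G w - M w v)) by ring]
    nlinarith

lemma one_sub (hF : HasJet F L Q C) :
    HasJet (fun w => 1 - F w) (fun w v => - L w v) (fun w v => - Q w v) (1 + C) := by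
  have hC := hF.nonneg
  refine ⟨fun w => ?_, fun w v => ?_, fun w v => ?_, fun w v => ?_, fun w v => ?_⟩
  · have := abs_sub (1 : ℝ) (F w)
    have := hF.bound w
    rw [abs_one] at *
    linarith
  · rw [abs_neg]; nlinarith [hF.linear_bound w v, norm_nonneg v]
  · rw [show 1 - F (w + v) - (1 - F w) = -(F (w + v) - F w) by ring, abs_neg]
    nlinarith [hF.order_zero w v, norm_nonneg v]
  · rw [show 1 - F (w + v) - (1 - F w) - -L w v = -(F (w + v) - F w - L w v) by ring, abs_neg]
    nlinarith [hF.order_one w v, sq_nonneg ‖v‖]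
  · rw [show 1 - F (w + v) - (1 - F w) - -L w v - -Q w v =
      -(F (w + v) - F w - L w v - Q w v) by ring, abs_neg]
    have : 0 ≤ ‖v‖ ^ 3 := by positivity
    nlinarith [hF.order_two w v]

lemma const_one : HasJet (fun _ : V => (1 : ℝ)) (fun _ _ => 0) (fun _ _ => 0) 1 := by
  refine ⟨fun w => ?_, fun w v => ?_, fun w v => ?_, fun w v => ?_, fun w v => ?_⟩ <;>
  simp

lemma comp_eval {α : Type*} [Fintype α] {g : ℝ → ℝ} {L Q : ℝ → ℝ → ℝ} (h : HasJet g L Q C) (a : α)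
    (c : ℝ) : HasJet (fun w : α → ℝ => g (w a - c)) (fun w v => L (w a - c) (v a))
      (fun w v => Q (w a - c) (v a)) C := by
  have hC := h.nonneg
  have hv : ∀ v : α → ℝ, ‖v a‖ ≤ ‖v‖ := fun v => norm_le_pi_norm v a
  have e : ∀ w v : α → ℝ, (w + v) a - c = (w a - c) + v a := fun w v => by simp; ring
  refine ⟨fun w => h.bound _, fun w v => ?_, fun w v => ?_, fun w v => ?_, fun w v => ?_⟩
  · exact (h.linear_bound _ _).trans (by gcongr; exact hv v)
  · rw [e]; exact (h.order_zero _ _).trans (by gcongr; exact hv v)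
  · rw [e]; exact (h.order_one _ _).trans (by gcongr; exact hv v)
  · rw [e]; exact (h.order_two _ _).trans (by gcongr; exact hv v)

end HasJet

/-- The mean value inequality on the ball of radius `|v|`. Iterating it produces Taylor remainders,
without the factorials. -/
lemma abs_le_mul_pow_succ_of_deriv {h h' : ℝ → ℝ} {C : ℝ} (k : ℕ) (h0 : h 0 = 0)
    (hd : ∀ v, HasDerivAt h (h' v) v) (hb : ∀ v, |h' v| ≤ C * |v| ^ k) (v : ℝ) :
    |h v| ≤ C * |v| ^ (k + 1) := by
  have hC : 0 ≤ C := by have := (abs_nonneg _).trans (hb 1); simpa using this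
  have := (convex_closedBall (0 : ℝ) |v|).norm_image_sub_le_of_norm_hasDerivWithin_le
    (f := h) (f' := h') (C := C * |v| ^ k) (x := 0) (y := v)
    (fun x _ => (hd x).hasDerivWithinAt) (fun x hx => by
      rw [mem_closedBall_zero_iff, Real.norm_eq_abs] at hx
      exact (hb x).trans (by gcongr)) (by simp) (by simp)
  rw [h0] at this
  simpa [pow_succ, mul_assoc] using this

/-- The smooth step has a uniform second-order expansion with nonnegative slope. -/
lemma exists_hasJet_smoothTransition : ∃ (C : ℝ) (g₁ g₂ : ℝ → ℝ), (∀ x, 0 ≤ g₁ x) ∧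
    HasJet Real.smoothTransition (fun w v => g₁ w * v) (fun w v => g₂ w * v * v) C := by
  set g := Real.smoothTransition
  have hg : ContDiff ℝ ((⊤ : ℕ∞) : WithTop ℕ∞) g := Real.smoothTransition.contDiff
  have hd : ∀ f : ℝ → ℝ, ContDiff ℝ ((⊤ : ℕ∞) : WithTop ℕ∞) f →
      ContDiff ℝ ((⊤ : ℕ∞) : WithTop ℕ∞) (deriv f) := fun f hf =>
    (contDiff_infty_iff_deriv.1 hf).2
  have hD : ∀ f : ℝ → ℝ, ContDiff ℝ ((⊤ : ℕ∞) : WithTop ℕ∞) f → ∀ x, HasDerivAt f (deriv f x) x :=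
    fun f hf x => ((contDiff_infty_iff_deriv.1 hf).1 x).hasDerivAt
  -- The smooth step is constant on each side of `[0, 1]`, so all its derivatives vanish off this
  -- interval and are bounded by compactness.
  have hbd : ∀ f : ℝ → ℝ, ContDiff ℝ ((⊤ : ℕ∞) : WithTop ℕ∞) f →
      (∀ x, x ∉ Set.Icc (0 : ℝ) 1 → f x = 0) → ∃ C, ∀ x, |f x| ≤ C := by
    intro f hf h0
    obtain ⟨C, hC⟩ := isCompact_Icc.exists_bound_of_continuousOn (s := Set.Icc (0 : ℝ) 1)
      hf.continuous.continuousOn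
    refine ⟨max C 0, fun x => ?_⟩
    by_cases hx : x ∈ Set.Icc (0 : ℝ) 1
    · exact (hC x hx).trans (le_max_left _ _)
    · simp [h0 x hx]
  have hz : ∀ f : ℝ → ℝ, (∀ x, x ∉ Set.Icc (0 : ℝ) 1 → f x = 0) →
      ∀ x, x ∉ Set.Icc (0 : ℝ) 1 → deriv f x = 0 := by
    intro f hf x hx
    have : f =ᶠ[𝓝 x] fun _ => 0 := by
      filter_upwards [isClosed_Icc.isOpen_compl.mem_nhds hx] with y hy using hf y hy
    rw [this.deriv_eq]; simp
  have z1 : ∀ x, x ∉ Set.Icc (0 : ℝ) 1 → deriv g x = 0 := by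
    intro x hx
    rw [Set.mem_Icc, not_and_or, not_le, not_le] at hx
    rcases hx with hx | hx
    · have : g =ᶠ[𝓝 x] fun _ => 0 := by
        filter_upwards [isOpen_Iio.mem_nhds hx] with y hy
        exact Real.smoothTransition.zero_of_nonpos (le_of_lt hy)
      rw [this.deriv_eq]; simp
    · have : g =ᶠ[𝓝 x] fun _ => 1 := by
        filter_upwards [isOpen_Ioi.mem_nhds hx] with y hy
        exact Real.smoothTransition.one_of_one_le (le_of_lt hy)
      rw [this.deriv_eq]; simp
  have c1 := hd g hg
  have c2 := hd _ c1
  have c3 := hd _ c2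
  obtain ⟨C1, hC1⟩ := hbd _ c1 z1
  obtain ⟨C2, hC2⟩ := hbd _ c2 (hz _ z1)
  obtain ⟨C3, hC3⟩ := hbd _ c3 (hz _ (hz _ z1))
  have t0 : ∀ f : ℝ → ℝ, ContDiff ℝ ((⊤ : ℕ∞) : WithTop ℕ∞) f → ∀ w v,
      HasDerivAt (fun v => f (w + v)) (deriv f (w + v)) v := fun f hf w v =>
    HasDerivAt.comp_const_add w v (hD f hf _)
  have s0 : ∀ (f : ℝ → ℝ) (C : ℝ), ContDiff ℝ ((⊤ : ℕ∞) : WithTop ℕ∞) f → (∀ x, |deriv f x| ≤ C) →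
      ∀ w v, |f (w + v) - f w| ≤ C * |v| := by
    intro f C hf hC w v
    have := abs_le_mul_pow_succ_of_deriv (h := fun v => f (w + v) - f w)
      (h' := fun v => deriv f (w + v)) (C := C) 0 (by simp)
      (fun v => (t0 f hf w v).sub_const _) (fun v => by simpa using hC _) v
    simpa using this
  have s1 : ∀ (f : ℝ → ℝ) (C : ℝ), ContDiff ℝ ((⊤ : ℕ∞) : WithTop ℕ∞) f →
      (∀ x, |deriv (deriv f) x| ≤ C) →
      ∀ w v, |f (w + v) - f w - deriv f w * v| ≤ C * |v| ^ 2 := by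
    intro f C hf hC w v
    exact abs_le_mul_pow_succ_of_deriv (h := fun v => f (w + v) - f w - deriv f w * v)
      (h' := fun v => deriv f (w + v) - deriv f w) (C := C) 1 (by simp)
      (fun v => ((t0 f hf w v).sub_const _).sub
        (by simpa using (hasDerivAt_id v).const_mul (deriv f w)))
      (fun v => by simpa using s0 _ C (hd f hf) hC w v) v
  have s2 : ∀ w v, |g (w + v) - g w - deriv g w * v - deriv (deriv g) w / 2 * v * v| ≤
      C3 * |v| ^ 3 := by
    intro w v
    refine abs_le_mul_pow_succ_of_deriv
      (h := fun v => g (w + v) - g w - deriv g w * v - deriv (deriv g) w / 2 * v * v)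
      (h' := fun v => deriv g (w + v) - deriv g w - deriv (deriv g) w * v) (C := C3) 2 (by simp)
      (fun v => (((t0 g hg w v).sub_const _).sub
        (by simpa using (hasDerivAt_id v).const_mul (deriv g w))).sub ?_)
      (fun v => s1 _ C3 c1 hC3 w v) v
    have := ((hasDerivAt_id v).const_mul (deriv (deriv g) w / 2)).mul (hasDerivAt_id v)
    convert! this using 1
    simp; ring
  have p1 : 0 ≤ C1 := (abs_nonneg _).trans (hC1 0)
  have p2 : 0 ≤ C2 := (abs_nonneg _).trans (hC2 0)
  have p3 : 0 ≤ C3 := (abs_nonneg _).trans (hC3 0)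
  refine ⟨1 + C1 + C2 + C3, deriv g, fun x => deriv (deriv g) x / 2,
    fun x => Real.smoothTransition.monotone.deriv_nonneg, ?_⟩
  refine ⟨fun w => ?_, fun w v => ?_, fun w v => ?_, fun w v => ?_, fun w v => ?_⟩
  · rw [abs_of_nonneg (Real.smoothTransition.nonneg w)]
    linarith [Real.smoothTransition.le_one w]
  · rw [abs_mul, Real.norm_eq_abs]
    gcongr
    linarith [hC1 w]
  · refine (s0 g C1 hg hC1 w v).trans ?_
    rw [Real.norm_eq_abs]; gcongr; linarith
  · refine (s1 g C2 hg hC2 w v).trans ?_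
    rw [Real.norm_eq_abs]; gcongr; linarith
  · refine (s2 w v).trans ?_
    rw [Real.norm_eq_abs]; gcongr; linarith

end Jets

/-! ### Gordon's comparison for finite Gaussian arrays. -/

section Gordon

variable {ι κ : Type*} [Fintype ι] [Fintype κ]

/-- `HasJet` with the linear and quadratic forms given by their coefficients. -/
def HasCoeffJet {α : Type*} [Fintype α] (F : (α → ℝ) → ℝ) (l : (α → ℝ) → α → ℝ)
    (q : (α → ℝ) → α → α → ℝ) (C : ℝ) : Prop :=
  HasJet F (fun w v => ∑ a, l w a * v a) (fun w v => ∑ a, ∑ b, q w a b * (v a * v b)) C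

lemma HasCoeffJet.mul {α : Type*} [Fintype α] {F G : (α → ℝ) → ℝ} {l m : (α → ℝ) → α → ℝ}
    {q r : (α → ℝ) → α → α → ℝ} {C D : ℝ} (hF : HasCoeffJet F l q C) (hG : HasCoeffJet G m r D) :
    HasCoeffJet (fun w => F w * G w) (fun w a => F w * m w a + G w * l w a)
      (fun w a b => F w * r w a b + G w * q w a b + l w a * m w b) (4 * C * D) := by
  have := HasJet.mul hF hG
  unfold HasCoeffJet
  convert this using 3 with w v w v
  · simp only [Finset.mul_sum, ← Finset.sum_add_distrib]
    exact Finset.sum_congr rfl fun _ _ => by ring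
  · rw [Finset.sum_mul_sum]
    simp only [Finset.mul_sum, ← Finset.sum_add_distrib]
    exact Finset.sum_congr rfl fun _ _ => Finset.sum_congr rfl fun _ _ => by ring

/-- Functions of the `i`-th row with values in `[0, 1]`, nonincreasing in each entry. -/
def IsRowJet (i : ι) (F : (ι × κ → ℝ) → ℝ) : Prop :=
  (∀ w, 0 ≤ F w ∧ F w ≤ 1) ∧ ∃ C l q, HasCoeffJet F l q C ∧ (∀ w a, l w a ≤ 0) ∧
    (∀ w a, a.1 ≠ i → l w a = 0) ∧ (∀ w a b, a.1 ≠ b.1 → q w a b = 0) ∧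
    (∀ w a b, a.1 ≠ i → q w a b = 0)

/-- Nonnegative functions, nondecreasing in each entry, whose second derivatives in entries of
different rows are nonnegative. -/
def IsMinMaxJet (F : (ι × κ → ℝ) → ℝ) : Prop :=
  (∀ w, 0 ≤ F w) ∧ ∃ C l q, HasCoeffJet F l q C ∧ (∀ w a, 0 ≤ l w a) ∧
    (∀ w a b, a.1 ≠ b.1 → 0 ≤ q w a b)

/-- The only new quadratic coefficient is `l a * m b`. It vanishes for entries of different rows
because both linear parts live in row `i`. -/
lemma IsRowJet.mul {i : ι} {F G : (ι × κ → ℝ) → ℝ} (hF : IsRowJet i F) (hG : IsRowJet i G) :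
    IsRowJet i (fun w => F w * G w) := by
  obtain ⟨bF, C, l, q, hF, l1, l2, q1, q2⟩ := hF
  obtain ⟨bG, D, m, r, hG, m1, m2, r1, r2⟩ := hG
  refine ⟨fun w => ⟨mul_nonneg (bF w).1 (bG w).1, mul_le_one₀ (bF w).2 (bG w).1 (bG w).2⟩,
    _, _, _, hF.mul hG, fun w a => ?_, fun w a h => ?_, fun w a b h => ?_, fun w a b h => ?_⟩
  · nlinarith [l1 w a, m1 w a, bF w, bG w]
  · simp [l2 w a h, m2 w a h]
  · have : l w a * m w b = 0 := by
      by_cases ha : a.1 = i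
      · rw [m2 w b (fun hb => h (ha.trans hb.symm)), mul_zero]
      · rw [l2 w a ha, zero_mul]
    simp [q1 w a b h, r1 w a b h, this]
  · simp [q2 w a b h, r2 w a b h, l2 w a h]

lemma IsRowJet.const_one {i : ι} : IsRowJet i (fun _ : ι × κ → ℝ => (1 : ℝ)) :=
  ⟨fun _ => by norm_num, 1, fun _ _ => 0, fun _ _ _ => 0,
    by simpa [HasCoeffJet] using HasJet.const_one, by simp, by simp, by simp, by simp⟩

lemma IsRowJet.prod {i : ι} {α : Type*} (s : Finset α) {F : α → (ι × κ → ℝ) → ℝ}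
    (h : ∀ j ∈ s, IsRowJet i (F j)) : IsRowJet i (fun w => ∏ j ∈ s, F j w) := by
  classical
  induction s using Finset.induction_on with
  | empty => simpa using IsRowJet.const_one
  | insert a s ha ih =>
    simp only [Finset.prod_insert ha]
    exact (h a (Finset.mem_insert_self _ _)).mul
      (ih fun j hj => h j (Finset.mem_insert_of_mem hj))

lemma IsRowJet.one_sub {i : ι} {F : (ι × κ → ℝ) → ℝ} (hF : IsRowJet i F) :
    IsMinMaxJet (fun w => 1 - F w) := by
  obtain ⟨bF, C, l, q, hF, l1, l2, q1, q2⟩ := hF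
  refine ⟨fun w => by linarith [(bF w).2], 1 + C, fun w a => - l w a, fun w a b => - q w a b,
    ?_, fun w a => by linarith [l1 w a], fun w a b h => by simp [q1 w a b h]⟩
  have := HasJet.one_sub hF
  unfold HasCoeffJet
  convert this using 3 <;> simp

/-- Monotonicity is carried along for this step: the new mixed coefficient `l a * m b` is
nonnegative because both linear parts are. -/
lemma IsMinMaxJet.mul {F G : (ι × κ → ℝ) → ℝ} (hF : IsMinMaxJet F) (hG : IsMinMaxJet G) :
    IsMinMaxJet (fun w => F w * G w) := by
  obtain ⟨bF, C, l, q, hF, l1, q1⟩ := hF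
  obtain ⟨bG, D, m, r, hG, m1, r1⟩ := hG
  refine ⟨fun w => mul_nonneg (bF w) (bG w),
    _, _, _, hF.mul hG, fun w a => ?_, fun w a b h => ?_⟩
  · exact add_nonneg (mul_nonneg (bF w) (m1 w a)) (mul_nonneg (bG w) (l1 w a))
  · exact add_nonneg (add_nonneg (mul_nonneg (bF w) (r1 w a b h)) (mul_nonneg (bG w) (q1 w a b h)))
      (mul_nonneg (l1 w a) (m1 w b))

lemma IsMinMaxJet.prod {α : Type*} (s : Finset α) {F : α → (ι × κ → ℝ) → ℝ}
    (h : ∀ j ∈ s, IsMinMaxJet (F j)) : IsMinMaxJet (fun w => ∏ j ∈ s, F j w) := by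
  classical
  induction s using Finset.induction_on with
  | empty =>
    exact ⟨fun _ => by norm_num, 1, fun _ _ => 0, fun _ _ _ => 0,
      by simpa [HasCoeffJet] using HasJet.const_one, by simp, by simp⟩
  | insert a s ha ih =>
    simp only [Finset.prod_insert ha]
    exact (h a (Finset.mem_insert_self _ _)).mul
      (ih fun j hj => h j (Finset.mem_insert_of_mem hj))

lemma isRowJet_one_sub_smoothTransition (a : ι × κ) (c : ℝ) :
    IsRowJet a.1 (fun w : ι × κ → ℝ => 1 - Real.smoothTransition (w a - c)) := by
  classical
  obtain ⟨C, g₁, g₂, h0, h⟩ := exists_hasJet_smoothTransition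
  refine ⟨fun w => ⟨by linarith [Real.smoothTransition.le_one (w a - c)],
    by linarith [Real.smoothTransition.nonneg (w a - c)]⟩, 1 + C,
    fun w b => if b = a then - g₁ (w a - c) else 0,
    fun w b d => if b = a then if d = a then - g₂ (w a - c) else 0 else 0, ?_, ?_, ?_, ?_, ?_⟩
  · have := (h.comp_eval a c).one_sub
    unfold HasCoeffJet
    convert this using 3 with w v w v
    · simp
    · simp [mul_assoc, ite_mul]
  · intro w b
    dsimp only
    split_ifs
    · linarith [h0 (w a - c)]
    · rfl
  · intro w b hb
    exact if_neg fun h => hb (congrArg Prod.fst h)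
  · intro w b d hb
    dsimp only
    split_ifs with h1 h2
    · exact absurd (by rw [h1, h2]) hb
    · rfl
    · rfl
  · intro w b d hb
    exact if_neg fun h => hb (congrArg Prod.fst h)

/-- A smooth version of the indicator of `{∀ i, ∃ j, c < w i j}`. -/
def smoothMinMax (c : ℝ) (w : ι × κ → ℝ) : ℝ :=
  ∏ i, (1 - ∏ j, (1 - Real.smoothTransition (w (i, j) - c)))

lemma isMinMaxJet_smoothMinMax (c : ℝ) : IsMinMaxJet (smoothMinMax (ι := ι) (κ := κ) c) :=
  IsMinMaxJet.prod _ fun i _ => (IsRowJet.prod _ fun j _ =>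
    isRowJet_one_sub_smoothTransition (i, j) c).one_sub

omit [Fintype ι] in
lemma row_mem_Icc (c : ℝ) (w : ι × κ → ℝ) (i : ι) :
    1 - ∏ j, (1 - Real.smoothTransition (w (i, j) - c)) ∈ Set.Icc (0 : ℝ) 1 := by
  have h1 : ∏ j, (1 - Real.smoothTransition (w (i, j) - c)) ≤ 1 :=
    Finset.prod_le_one (fun j _ => by linarith [Real.smoothTransition.le_one (w (i, j) - c)])
      fun j _ => by linarith [Real.smoothTransition.nonneg (w (i, j) - c)]
  have h2 : 0 ≤ ∏ j, (1 - Real.smoothTransition (w (i, j) - c)) :=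
    Finset.prod_nonneg fun j _ => by linarith [Real.smoothTransition.le_one (w (i, j) - c)]
  constructor <;> linarith

lemma smoothMinMax_le_one (c : ℝ) (w : ι × κ → ℝ) : smoothMinMax c w ≤ 1 :=
  Finset.prod_le_one (fun i _ => (row_mem_Icc c w i).1) fun i _ => (row_mem_Icc c w i).2

lemma smoothMinMax_nonneg (c : ℝ) (w : ι × κ → ℝ) : 0 ≤ smoothMinMax c w :=
  Finset.prod_nonneg (fun i _ => (row_mem_Icc c w i).1)

lemma smoothMinMax_eq_one {c : ℝ} {w : ι × κ → ℝ} (h : ∀ i, ∃ j, c + 1 ≤ w (i, j)) :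
    smoothMinMax c w = 1 := by
  refine Finset.prod_eq_one fun i _ => ?_
  obtain ⟨j, hj⟩ := h i
  rw [Finset.prod_eq_zero (Finset.mem_univ j), sub_zero]
  rw [Real.smoothTransition.one_of_one_le (by linarith), sub_self]

lemma smoothMinMax_eq_zero {c : ℝ} {w : ι × κ → ℝ} (h : ¬ ∀ i, ∃ j, c ≤ w (i, j)) :
    smoothMinMax c w = 0 := by
  push Not at h
  obtain ⟨i, hi⟩ := h
  refine Finset.prod_eq_zero (Finset.mem_univ i) ?_
  rw [Finset.prod_eq_one, sub_self]
  intro j _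
  rw [Real.smoothTransition.zero_of_nonpos (by linarith [hi j]), sub_zero]

/-- Smooth form of Gordon's comparison inequality. -/
theorem IsMinMaxJet.integral_le {F : (ι × κ → ℝ) → ℝ} (hF : IsMinMaxJet F)
    {μ ν : Measure (ι × κ → ℝ)} [IsGaussian μ] [IsGaussian ν]
    (hμ : ∫ x, x ∂μ = 0) (hν : ∫ x, x ∂ν = 0)
    (heq : ∀ a b : ι × κ, a.1 = b.1 → ∫ x, x a * x b ∂μ = ∫ x, x a * x b ∂ν)
    (hle : ∀ a b : ι × κ, a.1 ≠ b.1 → ∫ x, x a * x b ∂ν ≤ ∫ x, x a * x b ∂μ) :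
    ∫ x, F x ∂ν ≤ ∫ x, F x ∂μ := by
  obtain ⟨-, C, l, q, hJ, hl, hq⟩ := hF
  have hC := hJ.nonneg
  have i3 : ∀ (ρ : Measure (ι × κ → ℝ)) [IsGaussian ρ], Integrable (fun x => ‖x‖ ^ 3) ρ := by
    intro ρ _
    have := (IsGaussian.memLp_id ρ 3 (by norm_num)).integrable_norm_pow (by norm_num)
    simpa using this
  have i1 : ∀ (ρ : Measure (ι × κ → ℝ)) [IsGaussian ρ] (a : ι × κ), Integrable (fun x => x a) ρ := by
    intro ρ _ a
    exact IsGaussian.integrable_dual ρ (ContinuousLinearMap.proj a)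
  have m2 : ∀ (ρ : Measure (ι × κ → ℝ)) [IsGaussian ρ] (a : ι × κ), MemLp (fun x => x a) 2 ρ := by
    intro ρ _ a
    exact IsGaussian.memLp_dual ρ (ContinuousLinearMap.proj a) 2 (by norm_num)
  have i2 : ∀ (ρ : Measure (ι × κ → ℝ)) [IsGaussian ρ] (a b : ι × κ),
      Integrable (fun x => x a * x b) ρ := fun ρ _ a b => (m2 ρ a).integrable_mul (m2 ρ b)
  have z1 : ∀ (ρ : Measure (ι × κ → ℝ)) [IsGaussian ρ], ∫ x, x ∂ρ = 0 → ∀ a, ∫ x, x a ∂ρ = 0 := by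
    intro ρ _ h0 a
    have := IsGaussian.integral_dual (μ := ρ) (ContinuousLinearMap.proj (R := ℝ) (φ := fun _ => ℝ) a)
    simpa [h0] using this
  -- Centering kills the linear term, the quadratic term yields `δ` times the covariances, and the
  -- third moment controls a remainder of order `δ ^ (3/2)`.
  have expand : ∀ (ρ : Measure (ι × κ → ℝ)) [IsGaussian ρ], ∫ x, x ∂ρ = 0 → ∀ w, ∀ δ : ℝ, 0 ≤ δ →
      |∫ x, F (w + √δ • x) ∂ρ - (F w + δ * ∑ a, ∑ b, q w a b * ∫ x, x a * x b ∂ρ)| ≤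
        C * (δ * √δ) * ∫ x, ‖x‖ ^ 3 ∂ρ := by
    intro ρ _ h0 w δ hδ
    have hint : Integrable (fun x => F (w + √δ • x)) ρ :=
      Integrable.of_bound (C := C)
        (Continuous.aestronglyMeasurable (hJ.continuous.comp (by fun_prop)))
        (Eventually.of_forall fun x => hJ.bound _)
    have hL : Integrable (fun x : ι × κ → ℝ => ∑ a, l w a * (√δ • x) a) ρ := by
      refine integrable_finsetSum _ fun a _ => ?_
      simpa using ((i1 ρ a).const_mul √δ).const_mul (l w a)
    have hQ : Integrable (fun x : ι × κ → ℝ => ∑ a, ∑ b, q w a b * ((√δ • x) a * (√δ • x) b)) ρ := by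
      refine integrable_finsetSum _ fun a _ => integrable_finsetSum _ fun b _ => ?_
      have := ((i2 ρ a b).const_mul (√δ * √δ)).const_mul (q w a b)
      refine this.congr (Eventually.of_forall fun x => ?_)
      simp only [Pi.smul_apply, smul_eq_mul]; ring
    have eL : ∫ x : ι × κ → ℝ, ∑ a, l w a * (√δ • x) a ∂ρ = 0 := by
      rw [integral_finsetSum _ fun a _ => by
        simpa using ((i1 ρ a).const_mul √δ).const_mul (l w a)]
      refine Finset.sum_eq_zero fun a _ => ?_
      simp [integral_const_mul, z1 ρ h0]
    have eQ : ∫ x : ι × κ → ℝ, ∑ a, ∑ b, q w a b * ((√δ • x) a * (√δ • x) b) ∂ρ =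
        δ * ∑ a, ∑ b, q w a b * ∫ x, x a * x b ∂ρ := by
      have e : ∀ x : ι × κ → ℝ, ∀ a b, q w a b * ((√δ • x) a * (√δ • x) b) =
          (δ * q w a b) * (x a * x b) := by
        intro x a b
        simp only [Pi.smul_apply, smul_eq_mul]
        rw [show q w a b * (√δ * x a * (√δ * x b)) = (√δ * √δ) * q w a b * (x a * x b) by ring,
          Real.mul_self_sqrt hδ]
      simp only [e]
      rw [integral_finsetSum _ fun a _ => integrable_finsetSum _ fun b _ => (i2 ρ a b).const_mul _,
        Finset.mul_sum]
      refine Finset.sum_congr rfl fun a _ => ?_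
      rw [integral_finsetSum _ fun b _ => (i2 ρ a b).const_mul _, Finset.mul_sum]
      refine Finset.sum_congr rfl fun b _ => ?_
      rw [integral_const_mul]; ring
    have eT : ∫ x, F (w + √δ • x) ∂ρ - (F w + δ * ∑ a, ∑ b, q w a b * ∫ x, x a * x b ∂ρ) =
        ∫ x, (F (w + √δ • x) - F w - (∑ a, l w a * (√δ • x) a) -
          ∑ a, ∑ b, q w a b * ((√δ • x) a * (√δ • x) b)) ∂ρ := by
      have k1 : Integrable (fun x => F (w + √δ • x) - F w) ρ := hint.sub (integrable_const _)
      have k2 : Integrable (fun x => F (w + √δ • x) - F w - ∑ a, l w a * (√δ • x) a) ρ :=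
        k1.sub hL
      rw [integral_sub k2 hQ, integral_sub k1 hL, integral_sub hint (integrable_const _), eL, eQ]
      simp; ring
    rw [eT, ← Real.norm_eq_abs]
    refine (norm_integral_le_of_norm_le (g := fun x => C * (δ * √δ) * ‖x‖ ^ 3)
      ((i3 ρ).const_mul _) (Eventually.of_forall fun x => ?_)).trans_eq (integral_const_mul _ _)
    have := hJ.order_two w (√δ • x)
    rw [Real.norm_eq_abs]
    refine this.trans_eq ?_
    rw [norm_smul, Real.norm_of_nonneg (Real.sqrt_nonneg _), mul_pow,
      show √δ ^ 3 = (√δ * √δ) * √δ by ring, Real.mul_self_sqrt hδ]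
    ring
  refine integral_le_integral_of_perturbation hμ hν hJ.continuous
    (C := C * ∫ x, ‖x‖ ^ 3 ∂ν + C * ∫ x, ‖x‖ ^ 3 ∂μ) hJ.bound fun w δ hδ => ?_
  have h1 := (abs_le.1 (expand ν hν w δ hδ)).2
  have h2 := (abs_le.1 (expand μ hμ w δ hδ)).1
  -- Within a row the covariances agree, so the sign of `q` is irrelevant there; across rows `q` is
  -- nonnegative and the covariances are ordered.
  have h3 : ∑ a, ∑ b, q w a b * ∫ x, x a * x b ∂ν ≤ ∑ a, ∑ b, q w a b * ∫ x, x a * x b ∂μ := by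
    refine Finset.sum_le_sum fun a _ => Finset.sum_le_sum fun b _ => ?_
    by_cases h : a.1 = b.1
    · rw [heq a b h]
    · exact mul_le_mul_of_nonneg_left (hle a b h) (hq w a b h)
  have h4 := mul_le_mul_of_nonneg_left h3 hδ
  linarith

/-- **Gordon's comparison inequality** for the events `{∀ i, ∃ j, c ≤ X i j}`, with a unit loss in
the threshold. -/
theorem gordon_comparison {μ ν : Measure (ι × κ → ℝ)} [IsGaussian μ] [IsGaussian ν]
    (hμ : ∫ x, x ∂μ = 0) (hν : ∫ x, x ∂ν = 0)
    (heq : ∀ a b : ι × κ, a.1 = b.1 → ∫ x, x a * x b ∂μ = ∫ x, x a * x b ∂ν)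
    (hle : ∀ a b : ι × κ, a.1 ≠ b.1 → ∫ x, x a * x b ∂ν ≤ ∫ x, x a * x b ∂μ) (c : ℝ) :
    ν.real {x | ∀ i, ∃ j, c + 1 ≤ x (i, j)} ≤ μ.real {x | ∀ i, ∃ j, c ≤ x (i, j)} := by
  have hmeas : ∀ c : ℝ, MeasurableSet {x : ι × κ → ℝ | ∀ i, ∃ j, c ≤ x (i, j)} := fun c => by
    simp only [Set.ofPred_forall, Set.ofPred_exists]
    exact MeasurableSet.iInter fun i => MeasurableSet.iUnion fun j =>
      measurableSet_le measurable_const (measurable_pi_apply _)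
  have hJ := isMinMaxJet_smoothMinMax (ι := ι) (κ := κ) c
  have hcont : Continuous (smoothMinMax (ι := ι) (κ := κ) c) := by
    obtain ⟨-, C, l, q, h, -⟩ := hJ; exact h.continuous
  have hint : ∀ (ρ : Measure (ι × κ → ℝ)) [IsGaussian ρ], Integrable (smoothMinMax c) ρ :=
    fun ρ _ => Integrable.of_bound (C := 1) hcont.aestronglyMeasurable
      (Eventually.of_forall fun x => by
        rw [Real.norm_of_nonneg (smoothMinMax_nonneg _ _)]; exact smoothMinMax_le_one _ _)
  have h := hJ.integral_le hμ hν heq hle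
  calc ν.real {x | ∀ i, ∃ j, c + 1 ≤ x (i, j)}
      = ∫ x, Set.indicator {x | ∀ i, ∃ j, c + 1 ≤ x (i, j)} 1 x ∂ν := by
        rw [integral_indicator_one (hmeas _)]
    -- The smooth step climbs from 0 at `c` to 1 at `c + 1`, so its min-max product lies between the
    -- two indicators; this is the unit loss.
    _ ≤ ∫ x, smoothMinMax c x ∂ν := by
        refine integral_mono ((integrable_const (1 : ℝ)).indicator (hmeas _)) (hint ν) fun x => ?_
        by_cases hx : x ∈ {x : ι × κ → ℝ | ∀ i, ∃ j, c + 1 ≤ x (i, j)}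
        · rw [Set.indicator_of_mem hx, smoothMinMax_eq_one hx]; rfl
        · rw [Set.indicator_of_notMem hx]; exact smoothMinMax_nonneg _ _
    _ ≤ ∫ x, smoothMinMax c x ∂μ := h
    _ ≤ ∫ x, Set.indicator {x | ∀ i, ∃ j, c ≤ x (i, j)} 1 x ∂μ := by
        refine integral_mono (hint μ) ((integrable_const (1 : ℝ)).indicator (hmeas _)) fun x => ?_
        by_cases hx : x ∈ {x : ι × κ → ℝ | ∀ i, ∃ j, c ≤ x (i, j)}
        · rw [Set.indicator_of_mem hx]; exact smoothMinMax_le_one _ _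
        · rw [Set.indicator_of_notMem hx, smoothMinMax_eq_zero hx]
    _ = _ := by rw [integral_indicator_one (hmeas _)]

end Gordon

/-! ### Gaussian bilinear forms against sums of linear forms. -/

section Bilinear

/-- Each mixed term contains `u` or `u'`, so centering the first component alone makes the mixed
terms vanish. -/
lemma integral_add_mul_add_prod {Ω Ω' : Type*} [MeasurableSpace Ω] [MeasurableSpace Ω']
    {P : Measure Ω} {Q : Measure Ω'} [IsProbabilityMeasure P] [IsProbabilityMeasure Q]
    {u u' : Ω → ℝ} {v v' : Ω' → ℝ} (hu : MemLp u 2 P) (hu' : MemLp u' 2 P) (hv : MemLp v 2 Q)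
    (hv' : MemLp v' 2 Q) (zu : ∫ a, u a ∂P = 0) (zu' : ∫ a, u' a ∂P = 0) :
    ∫ p, (u p.1 + v p.2) * (u' p.1 + v' p.2) ∂(P.prod Q) =
      (∫ a, u a * u' a ∂P) + ∫ b, v b * v' b ∂Q := by
  have iu := hu.integrable (by norm_num)
  have iu' := hu'.integrable (by norm_num)
  have iv := hv.integrable (by norm_num)
  have iv' := hv'.integrable (by norm_num)
  have iuu : Integrable (fun a => u a * u' a) P := hu.integrable_mul hu'
  have ivv : Integrable (fun a => v a * v' a) Q := hv.integrable_mul hv'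
  have e : ∀ p : Ω × Ω', (u p.1 + v p.2) * (u' p.1 + v' p.2) =
      (u p.1 * u' p.1) * 1 + u p.1 * v' p.2 + u' p.1 * v p.2 + 1 * (v p.2 * v' p.2) := by
    intro p; ring
  simp only [e]
  have j1 : Integrable (fun p : Ω × Ω' => (u p.1 * u' p.1) * (1 : ℝ)) (P.prod Q) :=
    iuu.mul_prod (integrable_const (1 : ℝ))
  have j2 : Integrable (fun p : Ω × Ω' => u p.1 * v' p.2) (P.prod Q) := iu.mul_prod iv'
  have j3 : Integrable (fun p : Ω × Ω' => u' p.1 * v p.2) (P.prod Q) := iu'.mul_prod iv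
  have j4 : Integrable (fun p : Ω × Ω' => (1 : ℝ) * (v p.2 * v' p.2)) (P.prod Q) :=
    (integrable_const (1 : ℝ)).mul_prod ivv
  have j12 : Integrable (fun p : Ω × Ω' => (u p.1 * u' p.1) * (1 : ℝ) + u p.1 * v' p.2)
    (P.prod Q) := j1.add j2
  have j123 : Integrable (fun p : Ω × Ω' => (u p.1 * u' p.1) * (1 : ℝ) + u p.1 * v' p.2 +
    u' p.1 * v p.2) (P.prod Q) := j12.add j3
  rw [integral_add j123 j4, integral_add j12 j3, integral_add j1 j2,
    integral_prod_mul (fun a => u a * u' a) (fun _ => (1 : ℝ)), integral_prod_mul u v',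
    integral_prod_mul u' v, integral_prod_mul (fun _ => (1 : ℝ)) (fun b => v b * v' b), zu, zu']
  simp

variable {G H Ω : Type*} [NormedAddCommGroup G] [InnerProductSpace ℝ G] [NormedAddCommGroup H]
  [InnerProductSpace ℝ H] [NormedAddCommGroup Ω] [NormedSpace ℝ Ω] [MeasurableSpace Ω]

/-- A Gaussian bilinear form on `G × H`: its coefficients in orthonormal bases are independent
standard normal variables. -/
structure IsGaussianForm (ρ : Measure Ω) (T : G → H → StrongDual ℝ Ω) : Prop where
  gaussian : IsGaussian ρ
  centered : ∫ A, A ∂ρ = 0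
  moment : ∀ x x' y y', ∫ A, T x y A * T x' y' A ∂ρ = inner ℝ x x' * inner ℝ y y'
  sub_left : ∀ x x' y, T (x - x') y = T x y - T x' y
  sub_right : ∀ x y y', T x (y - y') = T x y - T x y'
  bound : ∃ K : ℝ, ∀ x y A, |T x y A| ≤ K * ‖A‖ * ‖x‖ * ‖y‖

/-- Allows the set `S` to serve as the outer set for escape and as the inner set for trapping. -/
lemma IsGaussianForm.flip {ρ : Measure Ω} {T : G → H → StrongDual ℝ Ω}
    (h : IsGaussianForm ρ T) : IsGaussianForm ρ (fun y x => T x y) :=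
  ⟨h.gaussian, h.centered, fun x x' y y' => by simpa [mul_comm] using h.moment y y' x x',
    fun x x' y => h.sub_right y x x', fun x y y' => h.sub_left y y' x,
    h.bound.imp fun K hK x y A => by rw [mul_right_comm]; exact hK y x A⟩

variable [FiniteDimensional ℝ G] [MeasurableSpace G] [BorelSpace G] [FiniteDimensional ℝ H]
  [MeasurableSpace H] [BorelSpace H]

lemma integral_inner_mul_inner_stdGaussian (x y : G) :
    ∫ g, inner ℝ x g * inner ℝ y g ∂(stdGaussian G) = inner ℝ x y := by
  have h := covarianceBilin_apply (μ := stdGaussian G) IsGaussian.memLp_two_id x y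
  rw [covarianceBilin_stdGaussian] at h
  rw [innerSL_apply_apply] at h
  simpa using h.symm

lemma integral_inner_stdGaussian (x : G) : ∫ g, inner ℝ x g ∂(stdGaussian G) = 0 :=
  integral_strongDual_stdGaussian (innerSL ℝ x)

lemma memLp_inner_stdGaussian (x : G) : MemLp (fun g => inner ℝ x g) 2 (stdGaussian G) :=
  IsGaussian.memLp_dual _ (innerSL ℝ x) 2 (by norm_num)

variable [BorelSpace Ω] [SecondCountableTopology Ω] [CompleteSpace Ω]

/-- Gordon's comparison for a Gaussian bilinear form on finite subsets of the unit spheres. -/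
theorem gordon_bilinear {ρ : Measure Ω} {T : G → H → StrongDual ℝ Ω} (hT : IsGaussianForm ρ T)
    {ι κ : Type*} [Fintype ι] [Fintype κ] {x : ι → G} {y : κ → H} (hx : ∀ i, ‖x i‖ = 1)
    (hy : ∀ j, ‖y j‖ = 1) (c : ℝ) :
    ((stdGaussian G).prod (stdGaussian H)).real
        {p | ∀ i, ∃ j, c + 1 ≤ inner ℝ (x i) p.1 + inner ℝ (y j) p.2} ≤
      (ρ.prod (gaussianReal 0 1)).real {q | ∀ i, ∃ j, c ≤ T (x i) (y j) q.1 + q.2} := by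
  have := hT.gaussian
  let u : ι × κ → Ω →L[ℝ] ℝ := fun a => T (x a.1) (y a.2)
  let LX : Ω × ℝ →L[ℝ] (ι × κ → ℝ) := ContinuousLinearMap.pi fun a =>
    (u a).comp (ContinuousLinearMap.fst ℝ Ω ℝ) + ContinuousLinearMap.snd ℝ Ω ℝ
  let LY : G × H →L[ℝ] (ι × κ → ℝ) := ContinuousLinearMap.pi fun a =>
    (innerSL ℝ (x a.1)).comp (ContinuousLinearMap.fst ℝ G H) +
      (innerSL ℝ (y a.2)).comp (ContinuousLinearMap.snd ℝ G H)
  have eX : ∀ q a, LX q a = T (x a.1) (y a.2) q.1 + q.2 := fun q a => rfl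
  have eY : ∀ q a, LY q a = inner ℝ (x a.1) q.1 + inner ℝ (y a.2) q.2 := fun q a => rfl
  have iX : Integrable (fun q : Ω × ℝ => q) (ρ.prod (gaussianReal 0 1)) := IsGaussian.integrable_id
  have iY : Integrable (fun q : G × H => q) ((stdGaussian G).prod (stdGaussian H)) :=
    IsGaussian.integrable_id
  have zX : ∫ v, v ∂((ρ.prod (gaussianReal 0 1)).map LX) = 0 := by
    rw [integral_map (by fun_prop) (Continuous.aestronglyMeasurable (by fun_prop)),
      ContinuousLinearMap.integral_comp_comm _ iX]
    have : ∫ q : Ω × ℝ, q ∂(ρ.prod (gaussianReal 0 1)) = 0 := by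
      rw [Prod.ext_iff, fst_integral iX, snd_integral iX]
      refine ⟨?_, ?_⟩
      · rw [integral_fun_fst (f := fun a : Ω => a)]; simp [hT.centered]
      · rw [integral_fun_snd (f := fun a : ℝ => a)]; simp
    rw [this, map_zero]
  have zY : ∫ v, v ∂(((stdGaussian G).prod (stdGaussian H)).map LY) = 0 := by
    rw [integral_map (by fun_prop) (Continuous.aestronglyMeasurable (by fun_prop)),
      ContinuousLinearMap.integral_comp_comm _ iY]
    have : ∫ q : G × H, q ∂((stdGaussian G).prod (stdGaussian H)) = 0 := by
      rw [Prod.ext_iff, fst_integral iY, snd_integral iY]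
      refine ⟨?_, ?_⟩
      · rw [integral_fun_fst (f := fun a : G => a)]; simp
      · rw [integral_fun_snd (f := fun a : H => a)]; simp
    rw [this, map_zero]
  have mX : ∀ a b : ι × κ, ∫ v, v a * v b ∂((ρ.prod (gaussianReal 0 1)).map LX) =
      inner ℝ (x a.1) (x b.1) * inner ℝ (y a.2) (y b.2) + 1 := by
    intro a b
    rw [integral_map (by fun_prop) (Continuous.aestronglyMeasurable (by fun_prop))]
    simp only [eX]
    have z : ∀ a : ι × κ, ∫ A, T (x a.1) (y a.2) A ∂ρ = 0 := fun a => by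
      have := IsGaussian.integral_dual (μ := ρ) (u a)
      rw [hT.centered, map_zero] at this
      exact this
    rw [integral_add_mul_add_prod (u := fun A => T (x a.1) (y a.2) A)
      (u' := fun A => T (x b.1) (y b.2) A) (v := fun r : ℝ => r) (v' := fun r : ℝ => r)
      (IsGaussian.memLp_dual ρ (u a) 2 (by norm_num))
      (IsGaussian.memLp_dual ρ (u b) 2 (by norm_num)) IsGaussian.memLp_two_id
      IsGaussian.memLp_two_id (z a) (z b), hT.moment]
    congr 1
    have := variance_of_integral_eq_zero (X := fun r : ℝ => r) (μ := gaussianReal 0 1)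
      (Measurable.aemeasurable measurable_id') (by simp)
    rw [variance_fun_id_gaussianReal] at this
    simpa [sq] using this.symm
  have mY : ∀ a b : ι × κ, ∫ v, v a * v b ∂(((stdGaussian G).prod (stdGaussian H)).map LY) =
      inner ℝ (x a.1) (x b.1) + inner ℝ (y a.2) (y b.2) := by
    intro a b
    rw [integral_map (by fun_prop) (Continuous.aestronglyMeasurable (by fun_prop))]
    simp only [eY]
    rw [integral_add_mul_add_prod (u := fun g => inner ℝ (x a.1) g)
      (u' := fun g => inner ℝ (x b.1) g) (v := fun h => inner ℝ (y a.2) h)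
      (v' := fun h => inner ℝ (y b.2) h) (memLp_inner_stdGaussian _) (memLp_inner_stdGaussian _)
      (memLp_inner_stdGaussian _) (memLp_inner_stdGaussian _) (integral_inner_stdGaussian _)
      (integral_inner_stdGaussian _), integral_inner_mul_inner_stdGaussian,
      integral_inner_mul_inner_stdGaussian]
  -- With `a = ⟨x, x'⟩` and `b = ⟨y, y'⟩` the covariances differ by `a * b + 1 - a - b = (1 - a) *
  -- (1 - b)`, which is zero when `x = x'`.
  have key := gordon_comparison zX zY (fun a b hab => by
      rw [mX, mY, hab, real_inner_self_eq_norm_sq, hx]; ring) (fun a b _ => by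
      rw [mX, mY]
      have h1 : inner ℝ (x a.1) (x b.1) ≤ 1 := by
        simpa [hx] using real_inner_le_norm (x a.1) (x b.1)
      have h2 : inner ℝ (y a.2) (y b.2) ≤ 1 := by
        simpa [hy] using real_inner_le_norm (y a.2) (y b.2)
      nlinarith) c
  have hmeas : ∀ c : ℝ, MeasurableSet {x : ι × κ → ℝ | ∀ i, ∃ j, c ≤ x (i, j)} := fun c => by
    simp only [Set.ofPred_forall, Set.ofPred_exists]
    exact MeasurableSet.iInter fun i => MeasurableSet.iUnion fun j =>
      measurableSet_le measurable_const (measurable_pi_apply _)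
  rw [map_measureReal_apply (by fun_prop) (hmeas _),
    map_measureReal_apply (by fun_prop) (hmeas _)] at key
  exact key

end Bilinear

/-! ### Support functions of subsets of the sphere, and nets. -/

section Support

variable {G H Ω : Type*} [NormedAddCommGroup G] [InnerProductSpace ℝ G] [NormedAddCommGroup H]
  [InnerProductSpace ℝ H]

/-- The support function `g ↦ sup_{w ∈ S} ⟨g, w⟩`. -/
def supportFn (S : Set G) (g : G) : ℝ := sSup ((fun w : G => inner ℝ g w) '' S)

variable {S : Set G}

lemma inner_le_norm_of_unit {w : G} (hw : ‖w‖ = 1) (g : G) : inner ℝ g w ≤ ‖g‖ := by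
  simpa [hw] using real_inner_le_norm g w

lemma inner_le_supportFn (hS : S ⊆ Metric.sphere 0 1) {w : G} (hw : w ∈ S) (g : G) :
    inner ℝ g w ≤ supportFn S g := by
  refine le_csSup ⟨‖g‖, ?_⟩ ⟨w, hw, rfl⟩
  rintro _ ⟨v, hv, rfl⟩
  exact inner_le_norm_of_unit (by simpa using hS hv) g

lemma supportFn_le (hne : S.Nonempty) {g : G} {c : ℝ} (h : ∀ w ∈ S, inner ℝ g w ≤ c) :
    supportFn S g ≤ c := by
  refine csSup_le (hne.image _) ?_
  rintro _ ⟨v, hv, rfl⟩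
  exact h v hv

lemma supportFn_le_norm (hS : S ⊆ Metric.sphere 0 1) (hne : S.Nonempty) (g : G) :
    supportFn S g ≤ ‖g‖ :=
  supportFn_le hne fun w hw => inner_le_norm_of_unit (by simpa using hS hw) g

lemma abs_supportFn_sub_le (hS : S ⊆ Metric.sphere 0 1) (hne : S.Nonempty) (g g' : G) :
    |supportFn S g - supportFn S g'| ≤ ‖g - g'‖ := by
  have key : ∀ g g' : G, supportFn S g ≤ supportFn S g' + ‖g - g'‖ := fun g g' =>
    supportFn_le hne fun w hw => by
      have h1 := inner_le_supportFn hS hw g'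
      have h2 := inner_le_norm_of_unit (by simpa using hS hw : ‖w‖ = 1) (g - g')
      rw [inner_sub_left] at h2
      linarith
  rw [abs_le]
  have h1 := key g g'
  have h2 := key g' g
  rw [norm_sub_rev] at h2
  constructor <;> linarith

lemma continuous_supportFn (hS : S ⊆ Metric.sphere 0 1) (hne : S.Nonempty) :
    Continuous (supportFn S) := by
  have : LipschitzWith 1 (supportFn S) := LipschitzWith.of_dist_le_mul fun x y => by
    simpa [Real.dist_eq, dist_eq_norm] using abs_supportFn_sub_le hS hne x y
  exact this.continuous

lemma abs_supportFn_le_norm (hS : S ⊆ Metric.sphere 0 1) (hne : S.Nonempty) (g : G) :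
    |supportFn S g| ≤ ‖g‖ := by
  have h0 : supportFn S (0 : G) = 0 := le_antisymm (supportFn_le hne fun w _ => by simp) (by
    obtain ⟨w, hw⟩ := hne
    simpa using inner_le_supportFn hS hw 0)
  simpa [h0] using abs_supportFn_sub_le hS hne g 0

lemma norm_le_supportFn_sphere [Nontrivial G] (g : G) :
    ‖g‖ ≤ supportFn (Metric.sphere (0 : G) 1) g := by
  by_cases hg : g = 0
  · obtain ⟨w, hw⟩ := (NormedSpace.sphere_nonempty (x := (0 : G)) (r := 1)).2 zero_le_one
    subst hg
    simpa using inner_le_supportFn subset_rfl hw (0 : G)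
  · have hn : ‖g‖ ≠ 0 := norm_ne_zero_iff.2 hg
    have hw : ‖g‖⁻¹ • g ∈ Metric.sphere (0 : G) 1 := by
      simp [norm_smul, hn]
    have := inner_le_supportFn subset_rfl hw g
    rw [real_inner_smul_right, real_inner_self_eq_norm_sq] at this
    convert this using 1
    field_simp

/-- The net is chosen inside `S`, not merely in the sphere, so that bounds valid on `S` hold at its
points and its support function stays below that of `S`. -/
lemma exists_finset_net [FiniteDimensional ℝ G] (hS : S ⊆ Metric.sphere 0 1) {ε : ℝ}
    (hε : 0 < ε) : ∃ t : Finset G, ↑t ⊆ S ∧ ∀ x ∈ S, ∃ y ∈ t, ‖x - y‖ ≤ ε := by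
  have : ProperSpace G := FiniteDimensional.proper_real G
  have htb : TotallyBounded S := (isCompact_sphere (0 : G) 1).totallyBounded.subset hS
  obtain ⟨t, htS, htf, ht⟩ := Metric.finite_approx_of_totallyBounded htb ε hε
  refine ⟨htf.toFinset, by simpa using htS, fun x hx => ?_⟩
  obtain ⟨y, hy, hxy⟩ := Set.mem_iUnion₂.1 (ht hx)
  exact ⟨y, by simpa using hy, by rw [← dist_eq_norm]; exact (Metric.mem_ball.1 hxy).le⟩

lemma supportFn_le_net (hS : S ⊆ Metric.sphere 0 1) (hne : S.Nonempty) {ε : ℝ}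
    {t : Set G} (htS : t ⊆ S) (ht : ∀ x ∈ S, ∃ y ∈ t, ‖x - y‖ ≤ ε) (g : G) :
    supportFn S g ≤ supportFn t g + ε * ‖g‖ := by
  refine supportFn_le hne fun w hw => ?_
  obtain ⟨y, hy, hyw⟩ := ht w hw
  have h1 := inner_le_supportFn (htS.trans hS) hy g
  have h2 := real_inner_le_norm g (w - y)
  rw [inner_sub_right] at h2
  have : ‖g‖ * ‖w - y‖ ≤ ‖g‖ * ε := by gcongr
  linarith

end Support

/-! ### From finite families to arbitrary subsets of the spheres. -/

section BilinearNet

/-- Symmetry and a union bound. It serves to remove the auxiliary variable `γ` at the price of a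
factor 2. -/
lemma half_le_gaussianReal_Iic : 1 ≤ 2 * gaussianReal 0 1 (Set.Iic 0) := by
  have h1 : gaussianReal 0 1 (Set.Ici 0) = gaussianReal 0 1 (Set.Iic 0) := by
    have := gaussianReal_map_neg (μ := 0) (v := 1)
    rw [neg_zero] at this
    conv_lhs => rw [← this]
    rw [Measure.map_apply (by fun_prop) measurableSet_Ici]
    congr 1
    ext x; simp
  calc (1 : ℝ≥0∞) = gaussianReal 0 1 (Set.Iic 0 ∪ Set.Ici 0) := by
        rw [Set.Iic_union_Ici]; simp
    _ ≤ _ := measure_union_le _ _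
    _ = _ := by rw [h1, two_mul]

lemma tendsto_measure_gt {Ω : Type*} [MeasurableSpace Ω] {P : Measure Ω} [IsFiniteMeasure P]
    {X : Ω → ℝ} (hX : Measurable X) :
    Tendsto (fun k : ℕ => P {ω | (k : ℝ) + 1 < X ω}) atTop (𝓝 0) := by
  have h0 : ⋂ k : ℕ, {ω | (k : ℝ) + 1 < X ω} = ∅ := by
    rw [Set.eq_empty_iff_forall_notMem]
    intro ω hω
    obtain ⟨k, hk⟩ := exists_nat_gt (X ω)
    have := Set.mem_iInter.1 hω k
    simp only [Set.mem_ofPred_eq] at this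
    linarith
  rw [← measure_empty (μ := P), ← h0]
  refine tendsto_measure_iInter_atTop (fun k => (measurableSet_lt measurable_const
    hX).nullMeasurableSet) ?_ ⟨0, measure_ne_top _ _⟩
  intro i j hij ω hω
  simp only [Set.mem_ofPred_eq] at hω ⊢
  have : (i : ℝ) ≤ j := by exact_mod_cast hij
  linarith

variable {G H Ω : Type*} [NormedAddCommGroup G] [InnerProductSpace ℝ G] [NormedAddCommGroup H]
  [InnerProductSpace ℝ H] [NormedAddCommGroup Ω] [NormedSpace ℝ Ω] [MeasurableSpace Ω]
  [FiniteDimensional ℝ G] [MeasurableSpace G] [BorelSpace G] [FiniteDimensional ℝ H]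
  [MeasurableSpace H] [BorelSpace H] [BorelSpace Ω] [SecondCountableTopology Ω] [CompleteSpace Ω]

lemma ennreal_le_two_mul_of_tendsto {a b : ℝ≥0∞} {u v : ℕ → ℝ≥0∞} (hu : Tendsto u atTop (𝓝 0))
    (hv : Tendsto v atTop (𝓝 0)) (h : ∀ k, a ≤ 2 * (b + u k) + v k) : a ≤ 2 * b := by
  have l4 := (ENNReal.Tendsto.const_mul (a := 2) ((tendsto_const_nhds (x := b)).add hu)
    (Or.inr (by norm_num))).add hv
  rw [add_zero, add_zero] at l4
  exact ge_of_tendsto' l4 h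

/-- Gordon's minimax bound for a Gaussian bilinear form on arbitrary subsets of the spheres. -/
theorem measure_exists_forall_le {ρ : Measure Ω} {T : G → H → StrongDual ℝ Ω}
    (hT : IsGaussianForm ρ T) {P : Set G} {Q : Set H} (hP : P ⊆ Metric.sphere 0 1)
    (hQ : Q ⊆ Metric.sphere 0 1) (hQne : Q.Nonempty) :
    ρ {A | ∃ x ∈ P, ∀ y ∈ Q, T x y A ≤ 0} ≤
      2 * ((stdGaussian G).prod (stdGaussian H))
        {p | supportFn Q p.2 - supportFn P (-p.1) ≤ 2} := by
  have := hT.gaussian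
  obtain ⟨K, hK⟩ := hT.bound
  set π := (stdGaussian G).prod (stdGaussian H)
  set B : Set (G × H) := {p | supportFn Q p.2 - supportFn P (-p.1) ≤ 2}
  have step : ∀ k : ℕ, ρ {A | ∃ x ∈ P, ∀ y ∈ Q, T x y A ≤ 0} ≤
      2 * (π B + π {p | (k : ℝ) + 1 < ‖p.2‖}) + ρ {A | (k : ℝ) + 1 < K * ‖A‖} := by
    intro k
    -- Unless `K * ‖A‖` or `‖h‖` exceeds `k + 1`, passing to a net costs at most `1/4`. Hence the
    -- form is at most `1/2` on the nets, below the threshold `3/4`; on the other side `3/4 + 1 +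
    -- 1/4 = 2` is the final constant. The exceptional events disappear as `k → ∞`.
    set ε : ℝ := 1 / (4 * (k + 1))
    have hε : 0 < ε := by positivity
    have hε' : ε * (k + 1) = 1 / 4 := by simp only [ε]; field_simp
    obtain ⟨s, hsP, hs⟩ := exists_finset_net hP hε
    obtain ⟨t, htQ, ht⟩ := exists_finset_net hQ hε
    set Ek : Set Ω := {A | ∃ i : s, ∀ j : t, T i j A ≤ 1 / 2}
    set X : Set (Ω × ℝ) := {q | ∀ i : s, ∃ j : t, 3 / 4 ≤ T i j q.1 + q.2}
    set Y : Set (G × H) := {p | ∀ i : s, ∃ j : t, 3 / 4 + 1 ≤ inner ℝ (i : G) p.1 +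
      inner ℝ (j : H) p.2}
    have hg := gordon_bilinear hT (x := fun i : s => (i : G)) (y := fun j : t => (j : H))
      (fun i => by simpa using hP (hsP i.2)) (fun j => by simpa using hQ (htQ j.2)) (3 / 4)
    have hXm : MeasurableSet X := by
      simp only [X, Set.ofPred_forall, Set.ofPred_exists]
      exact MeasurableSet.iInter fun i => MeasurableSet.iUnion fun j =>
        measurableSet_le measurable_const (Continuous.measurable (by fun_prop))
    have hYm : MeasurableSet Y := by
      simp only [Y, Set.ofPred_forall, Set.ofPred_exists]
      exact MeasurableSet.iInter fun i => MeasurableSet.iUnion fun j =>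
        measurableSet_le measurable_const (Continuous.measurable (by fun_prop))
    have hXY : π Y ≤ (ρ.prod (gaussianReal 0 1)) X := by
      rwa [measureReal_def, measureReal_def,
        ENNReal.toReal_le_toReal (measure_ne_top _ _) (measure_ne_top _ _)] at hg
    have hc : (ρ.prod (gaussianReal 0 1)) Xᶜ ≤ π Yᶜ := by
      rw [prob_compl_eq_one_sub hXm, prob_compl_eq_one_sub hYm]
      exact tsub_le_tsub_left hXY _
    have h1 : {A | ∃ x ∈ P, ∀ y ∈ Q, T x y A ≤ 0} ⊆ Ek ∪ {A | (k : ℝ) + 1 < K * ‖A‖} := by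
      rintro A ⟨x, hx, hA⟩
      by_cases hn : (k : ℝ) + 1 < K * ‖A‖
      · exact Or.inr hn
      · left
        obtain ⟨x', hx', hxx⟩ := hs x hx
        refine ⟨⟨x', hx'⟩, fun j => ?_⟩
        have hj := hA j (htQ j.2)
        have hjn : ‖(j : H)‖ = 1 := by simpa using hQ (htQ j.2)
        have e : T x' j A = T x j A - T (x - x') j A := by
          rw [hT.sub_left]; simp
        have hb : |T (x - x') j A| ≤ 1 / 4 := by
          push Not at hn
          refine (hK _ _ _).trans ?_
          rw [hjn, mul_one, ← hε', mul_comm ε]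
          exact mul_le_mul hn hxx (norm_nonneg _) (by positivity)
        have := (abs_le.1 hb).1
        simp only
        linarith
    have h2 : Ek ×ˢ Set.Iic (0 : ℝ) ⊆ Xᶜ := by
      rintro ⟨A, r⟩ ⟨⟨i, hi⟩, hr⟩ hX
      obtain ⟨j, hj⟩ := hX i
      have := hi j
      simp only [Set.mem_Iic] at hr hj
      linarith
    have h3 : Yᶜ ⊆ B ∪ {p | (k : ℝ) + 1 < ‖p.2‖} := by
      intro p hp
      by_cases hn : (k : ℝ) + 1 < ‖p.2‖
      · exact Or.inr hn
      · left
        simp only [Y, Set.mem_compl_iff, Set.mem_ofPred_eq] at hp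
        push Not at hp hn
        obtain ⟨i, hi⟩ := hp
        have a1 : supportFn Q p.2 ≤ supportFn (t : Set H) p.2 + ε * ‖p.2‖ :=
          supportFn_le_net hQ hQne htQ ht p.2
        have tne : (t : Set H).Nonempty := by
          obtain ⟨y, hy⟩ := hQne
          obtain ⟨y', hy', -⟩ := ht y hy
          exact ⟨y', hy'⟩
        have a2 : supportFn (t : Set H) p.2 ≤ 7 / 4 - inner ℝ (i : G) p.1 :=
          supportFn_le tne fun w hw => by
            have := hi ⟨w, hw⟩
            rw [real_inner_comm]
            simp only at this
            linarith
        have a3 : inner ℝ (-p.1) (i : G) ≤ supportFn P (-p.1) :=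
          inner_le_supportFn hP (hsP i.2) _
        rw [inner_neg_left, real_inner_comm] at a3
        have a4 : ε * ‖p.2‖ ≤ 1 / 4 := by rw [← hε']; gcongr
        simp only [B, Set.mem_ofPred_eq]
        linarith
    have h4 : ρ Ek ≤ 2 * (π B + π {p | (k : ℝ) + 1 < ‖p.2‖}) := by
      calc ρ Ek = ρ Ek * 1 := (mul_one _).symm
        _ ≤ ρ Ek * (2 * gaussianReal 0 1 (Set.Iic 0)) := by exact mul_le_mul_right half_le_gaussianReal_Iic _
        _ = 2 * (ρ.prod (gaussianReal 0 1)) (Ek ×ˢ Set.Iic (0 : ℝ)) := by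
          rw [Measure.prod_prod]; ring
        _ ≤ 2 * (ρ.prod (gaussianReal 0 1)) Xᶜ := mul_le_mul_right (measure_mono h2) 2
        _ ≤ 2 * π Yᶜ := mul_le_mul_right hc 2
        _ ≤ 2 * π (B ∪ {p | (k : ℝ) + 1 < ‖p.2‖}) := mul_le_mul_right (measure_mono h3) 2
        _ ≤ _ := mul_le_mul_right (measure_union_le _ _) 2
    calc _ ≤ ρ (Ek ∪ {A | (k : ℝ) + 1 < K * ‖A‖}) := measure_mono h1
      _ ≤ ρ Ek + ρ {A | (k : ℝ) + 1 < K * ‖A‖} := measure_union_le _ _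
      _ ≤ _ := add_le_add_left h4 _
  have l1 : Tendsto (fun k : ℕ => π {p | (k : ℝ) + 1 < ‖p.2‖}) atTop (𝓝 0) :=
    tendsto_measure_gt measurable_snd.norm
  have l2 : Tendsto (fun k : ℕ => ρ {A | (k : ℝ) + 1 < K * ‖A‖}) atTop (𝓝 0) := by
    have hm : Measurable fun A : Ω => K * ‖A‖ := measurable_norm.const_mul K
    exact tendsto_measure_gt hm
  exact ennreal_le_two_mul_of_tendsto l1 l2 step

end BilinearNet

/-! ### Dimension-free concentration of the support function. -/

section Concentration

lemma lintegral_ofReal_le_of_tail {α β : Type*} [MeasurableSpace α] [MeasurableSpace β]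
    {P : Measure α} {Q : Measure β} {U : α → ℝ} {V : β → ℝ} (mU : Measurable U)
    (mV : Measurable V) (h : ∀ c, Q {b | c ≤ V b} ≤ P {a | c ≤ U a}) :
    ∫⁻ b, ENNReal.ofReal (V b) ∂Q ≤ ∫⁻ a, ENNReal.ofReal (U a) ∂P := by
  have e : ∀ x : ℝ, ENNReal.ofReal x = ENNReal.ofReal (max x 0) := fun x => by
    rcases le_total x 0 with hx | hx
    · simp [hx, ENNReal.ofReal_of_nonpos hx]
    · simp [hx]
  simp only [e (V _), e (U _)]
  rw [lintegral_eq_lintegral_meas_le Q (f := fun b => max (V b) 0)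
      (Eventually.of_forall fun _ => le_max_right _ _) (by fun_prop),
    lintegral_eq_lintegral_meas_le P (f := fun a => max (U a) 0)
      (Eventually.of_forall fun _ => le_max_right _ _) (by fun_prop)]
  refine setLIntegral_mono' measurableSet_Ioi fun t ht => ?_
  have ht' : ¬ t ≤ 0 := not_le.2 ht
  simpa [le_max_iff, ht'] using h t

/-- Strict tails are what the negative parts require: the complement of `{-c ≤ U}` is the strict
tail `{c < -U}`. -/
lemma lintegral_ofReal_le_of_tail_lt {α β : Type*} [MeasurableSpace α] [MeasurableSpace β]
    {P : Measure α} {Q : Measure β} {U : α → ℝ} {V : β → ℝ} (mU : Measurable U)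
    (mV : Measurable V) (h : ∀ c, Q {b | c < V b} ≤ P {a | c < U a}) :
    ∫⁻ b, ENNReal.ofReal (V b) ∂Q ≤ ∫⁻ a, ENNReal.ofReal (U a) ∂P := by
  have e : ∀ x : ℝ, ENNReal.ofReal x = ENNReal.ofReal (max x 0) := fun x => by
    rcases le_total x 0 with hx | hx
    · simp [hx, ENNReal.ofReal_of_nonpos hx]
    · simp [hx]
  simp only [e (V _), e (U _)]
  rw [lintegral_eq_lintegral_meas_lt Q (f := fun b => max (V b) 0)
      (Eventually.of_forall fun _ => le_max_right _ _) (by fun_prop),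
    lintegral_eq_lintegral_meas_lt P (f := fun a => max (U a) 0)
      (Eventually.of_forall fun _ => le_max_right _ _) (by fun_prop)]
  refine setLIntegral_mono' measurableSet_Ioi fun t ht => ?_
  have ht' : ¬ t < 0 := not_lt.2 (le_of_lt ht)
  simpa [lt_max_iff, ht'] using h t

/-- Stochastic domination implies domination of expectations. -/
lemma integral_le_integral_of_tail {α β : Type*} [MeasurableSpace α] [MeasurableSpace β]
    {P : Measure α} {Q : Measure β} [IsProbabilityMeasure P] [IsProbabilityMeasure Q]
    {U : α → ℝ} {V : β → ℝ} (mU : Measurable U) (mV : Measurable V)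
    (hU : Integrable U P) (hV : Integrable V Q)
    (h : ∀ c, Q {b | c ≤ V b} ≤ P {a | c ≤ U a}) : ∫ b, V b ∂Q ≤ ∫ a, U a ∂P := by
  rw [integral_eq_lintegral_pos_part_sub_lintegral_neg_part hU,
    integral_eq_lintegral_pos_part_sub_lintegral_neg_part hV]
  refine sub_le_sub (ENNReal.toReal_mono hU.lintegral_lt_top.ne
    (lintegral_ofReal_le_of_tail mU mV h)) (ENNReal.toReal_mono hV.neg.lintegral_lt_top.ne
    (lintegral_ofReal_le_of_tail_lt mV.neg mU.neg fun c => ?_))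
  have e1 : {a | c < (-U) a} = {a | -c ≤ U a}ᶜ := by ext a; simp [lt_neg]
  have e2 : {b | c < (-V) b} = {b | -c ≤ V b}ᶜ := by ext b; simp [lt_neg]
  refine (measure_mono e1.le).trans (le_trans ?_ (measure_mono e2.ge))
  rw [prob_compl_eq_one_sub (measurableSet_le measurable_const mU),
    prob_compl_eq_one_sub (measurableSet_le measurable_const mV)]
  exact tsub_le_tsub_left (h _) _

variable {H : Type*} [NormedAddCommGroup H] [InnerProductSpace ℝ H]

/-- The bilinear form `x₀ ⟨y, a⟩ + x₁ ⟨y, b⟩` of a pair `(a, b)`. -/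
def pairForm (x : E 2) (y : H) : StrongDual ℝ (H × H) :=
  x 0 • (innerSL ℝ y).comp (ContinuousLinearMap.fst ℝ H H) +
    x 1 • (innerSL ℝ y).comp (ContinuousLinearMap.snd ℝ H H)

lemma pairForm_apply (x : E 2) (y : H) (A : H × H) :
    pairForm x y A = x 0 * inner ℝ y A.1 + x 1 * inner ℝ y A.2 := rfl

variable [FiniteDimensional ℝ H] [MeasurableSpace H] [BorelSpace H]

lemma isGaussianForm_pairForm :
    IsGaussianForm ((stdGaussian H).prod (stdGaussian H)) (pairForm (H := H)) where
  gaussian := inferInstance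
  centered := by
    have iY : Integrable (fun q : H × H => q) ((stdGaussian H).prod (stdGaussian H)) :=
      IsGaussian.integrable_id
    rw [Prod.ext_iff, fst_integral iY, snd_integral iY]
    refine ⟨?_, ?_⟩
    · rw [integral_fun_fst (f := fun a : H => a)]; simp
    · rw [integral_fun_snd (f := fun a : H => a)]; simp
  moment x x' y y' := by
    simp only [pairForm_apply]
    rw [integral_add_mul_add_prod (u := fun g => x 0 * inner ℝ y g)
      (u' := fun g => x' 0 * inner ℝ y' g) (v := fun h => x 1 * inner ℝ y h)
      (v' := fun h => x' 1 * inner ℝ y' h) ((memLp_inner_stdGaussian _).const_mul _)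
      ((memLp_inner_stdGaussian _).const_mul _) ((memLp_inner_stdGaussian _).const_mul _)
      ((memLp_inner_stdGaussian _).const_mul _)
      (by rw [integral_const_mul, integral_inner_stdGaussian, mul_zero])
      (by rw [integral_const_mul, integral_inner_stdGaussian, mul_zero])]
    have e : ∀ r r' : ℝ, ∫ g, r * inner ℝ y g * (r' * inner ℝ y' g) ∂(stdGaussian H) =
        r * r' * inner ℝ y y' := fun r r' => by
      rw [← integral_inner_mul_inner_stdGaussian, ← integral_const_mul]
      exact integral_congr_ae (Eventually.of_forall fun g => by ring)
    rw [e, e]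
    rw [PiLp.inner_apply, Fin.sum_univ_two]
    simp; ring
  sub_left x x' y := by
    ext A <;> simp [pairForm] <;> ring
  sub_right x y y' := by
    ext A <;> simp [pairForm] <;> ring
  bound := by
    refine ⟨2, fun x y A => ?_⟩
    rw [pairForm_apply]
    have h0 : |x 0| ≤ ‖x‖ := PiLp.norm_apply_le x 0
    have h1 : |x 1| ≤ ‖x‖ := PiLp.norm_apply_le x 1
    have h2 : |inner ℝ y A.1| ≤ ‖y‖ * ‖A‖ := (abs_real_inner_le_norm _ _).trans (by
      gcongr; exact norm_fst_le A)
    have h3 : |inner ℝ y A.2| ≤ ‖y‖ * ‖A‖ := (abs_real_inner_le_norm _ _).trans (by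
      gcongr; exact norm_snd_le A)
    calc _ ≤ |x 0 * inner ℝ y A.1| + |x 1 * inner ℝ y A.2| := abs_add_le _ _
      _ ≤ ‖x‖ * (‖y‖ * ‖A‖) + ‖x‖ * (‖y‖ * ‖A‖) := by
        rw [abs_mul, abs_mul]
        gcongr
      _ = _ := by ring

lemma integrable_norm_stdGaussian : Integrable (fun g : H => ‖g‖) (stdGaussian H) :=
  (IsGaussian.integrable_id (μ := stdGaussian H)).norm

lemma integrable_supportFn {S : Set H} (hS : S ⊆ Metric.sphere 0 1) (hne : S.Nonempty) :
    Integrable (supportFn S) (stdGaussian H) :=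
  integrable_norm_stdGaussian.mono' (continuous_supportFn hS hne).aestronglyMeasurable
    (Eventually.of_forall fun g => abs_supportFn_le_norm hS hne g)

/-- Gordon's comparison with only two rows, `x` running over the standard basis of `ℝ²`. The form
then reads off two independent Gaussian vectors, so "every row reaches the level `c`" says that the
smaller of two independent copies of `σ`, plus `γ`, is at least `c`. On the comparison side there is
a single copy `σ(h)` plus the smaller coordinate of `p ∈ ℝ²`, which is at least `-‖p‖`. Integrating
the tails costs `E ‖p‖` and the unit loss. Finiteness of `t` matches the finite arrays and makes the
supremum attained. -/
lemma integral_supportFn_le_integral_min_of_finite {t : Finset H}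
    (ht : (t : Set H) ⊆ Metric.sphere 0 1) (hne : (t : Set H).Nonempty) :
    ∫ g, supportFn (t : Set H) g ∂(stdGaussian H) - ∫ p : E 2, ‖p‖ ∂(stdGaussian (E 2)) - 1 ≤
      ∫ q, min (supportFn (t : Set H) q.1) (supportFn (t : Set H) q.2)
        ∂((stdGaussian H).prod (stdGaussian H)) := by
  set σ := supportFn (t : Set H)
  have hσc : Continuous σ := continuous_supportFn ht hne
  have hσi : Integrable σ (stdGaussian H) := integrable_supportFn ht hne
  have hmax : ∀ g : H, ∃ y ∈ t, σ g = inner ℝ g y := fun g => by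
    obtain ⟨y, hy, hyt⟩ := t.exists_max_image (fun y => inner ℝ g y) hne
    exact ⟨y, hy, le_antisymm (supportFn_le hne hyt) (inner_le_supportFn ht hy g)⟩
  have i1 : Integrable (fun q : H × H => σ q.1) ((stdGaussian H).prod (stdGaussian H)) :=
    hσi.comp_fst _
  have i2 : Integrable (fun q : H × H => σ q.2) ((stdGaussian H).prod (stdGaussian H)) :=
    hσi.comp_snd _
  have iU1 : Integrable (fun q : H × H => min (σ q.1) (σ q.2))
      ((stdGaussian H).prod (stdGaussian H)) := i1.inf i2
  have iγ : Integrable (fun r : ℝ => r) (gaussianReal 0 1) := IsGaussian.integrable_id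
  have key := integral_le_integral_of_tail
    (P := ((stdGaussian H).prod (stdGaussian H)).prod (gaussianReal 0 1))
    (Q := (stdGaussian (E 2)).prod (stdGaussian H))
    (U := fun q => min (σ q.1.1) (σ q.1.2) + q.2) (V := fun p => - ‖p.1‖ + σ p.2 - 1)
    (Continuous.measurable (by fun_prop)) (Continuous.measurable (by fun_prop))
    ((iU1.comp_fst _).add (iγ.comp_snd _))
    (((integrable_norm_stdGaussian.neg.comp_fst _).add (hσi.comp_snd _)).sub (integrable_const _))
    (fun c => by
      have hg := gordon_bilinear (isGaussianForm_pairForm (H := H))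
        (x := fun i : Fin 2 => EuclideanSpace.single i (1 : ℝ)) (y := fun j : t => (j : H))
        (fun i => by simp) (fun j => by simpa using ht j.2) c
      rw [measureReal_def, measureReal_def,
        ENNReal.toReal_le_toReal (measure_ne_top _ _) (measure_ne_top _ _)] at hg
      refine (measure_mono ?_).trans (hg.trans (measure_mono ?_))
      · intro p hp i
        obtain ⟨y, hy, hyσ⟩ := hmax p.2
        refine ⟨⟨y, hy⟩, ?_⟩
        have h1 : - ‖p.1‖ ≤ p.1 i := (abs_le.1 (PiLp.norm_apply_le p.1 i)).1
        have h2 : inner ℝ (EuclideanSpace.single i (1 : ℝ)) p.1 = p.1 i := by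
          rw [EuclideanSpace.inner_single_left]; simp
        simp only [Set.mem_ofPred_eq] at hp
        rw [h2, real_inner_comm, ← hyσ]
        linarith
      · intro q hq
        obtain ⟨j, hj⟩ := hq 0
        obtain ⟨k, hk⟩ := hq 1
        have a1 := inner_le_supportFn ht j.2 q.1.1
        have a2 := inner_le_supportFn ht k.2 q.1.2
        rw [real_inner_comm] at a1 a2
        simp only [pairForm_apply] at hj hk
        simp at hj hk
        simp only [Set.mem_ofPred_eq]
        rw [← sub_le_iff_le_add, le_min_iff]
        constructor <;> linarith)
  have e1 : ∫ q : (H × H) × ℝ, (min (σ q.1.1) (σ q.1.2) + q.2)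
      ∂(((stdGaussian H).prod (stdGaussian H)).prod (gaussianReal 0 1)) =
      ∫ q, min (σ q.1) (σ q.2) ∂((stdGaussian H).prod (stdGaussian H)) := by
    rw [integral_add (iU1.comp_fst _) (iγ.comp_snd _),
      integral_fun_fst (f := fun q : H × H => min (σ q.1) (σ q.2)),
      integral_fun_snd (f := fun r : ℝ => r)]
    simp
  have e2 : ∫ p : E 2 × H, (- ‖p.1‖ + σ p.2 - 1) ∂((stdGaussian (E 2)).prod (stdGaussian H)) =
      ∫ g, σ g ∂(stdGaussian H) - ∫ p : E 2, ‖p‖ ∂(stdGaussian (E 2)) - 1 := by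
    have j1 : Integrable (fun p : E 2 × H => - ‖p.1‖) ((stdGaussian (E 2)).prod (stdGaussian H)) :=
      integrable_norm_stdGaussian.neg.comp_fst _
    have j2 : Integrable (fun p : E 2 × H => σ p.2) ((stdGaussian (E 2)).prod (stdGaussian H)) :=
      hσi.comp_snd _
    have j3 : Integrable (fun p : E 2 × H => - ‖p.1‖ + σ p.2)
      ((stdGaussian (E 2)).prod (stdGaussian H)) := j1.add j2
    rw [integral_sub j3 (integrable_const _), integral_add j1 j2,
      integral_fun_fst (f := fun p : E 2 => - ‖p‖), integral_fun_snd (f := σ), integral_neg]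
    simp; ring
  rw [e1, e2] at key
  exact key

/-- The constant in the concentration bound `measure_le_abs_supportFn_sub`. -/
def concentrationConst : ℝ := 2 * (∫ p : E 2, ‖p‖ ∂(stdGaussian (E 2)) + 3)

/-- A net of mesh `1 / (M + 1)`, with `M` the mean norm, changes the expected support function by at
most 1; this accounts for the 2. -/
lemma integral_supportFn_le_integral_min {S : Set H} (hS : S ⊆ Metric.sphere 0 1)
    (hne : S.Nonempty) :
    ∫ g, supportFn S g ∂(stdGaussian H) - ∫ p : E 2, ‖p‖ ∂(stdGaussian (E 2)) - 2 ≤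
      ∫ q, min (supportFn S q.1) (supportFn S q.2) ∂((stdGaussian H).prod (stdGaussian H)) := by
  set M := ∫ g : H, ‖g‖ ∂(stdGaussian H)
  have hM : 0 ≤ M := integral_nonneg fun _ => norm_nonneg _
  obtain ⟨t, htS, ht⟩ := exists_finset_net hS (ε := 1 / (M + 1)) (by positivity)
  have htS' := htS.trans hS
  have htne : (t : Set H).Nonempty := by
    obtain ⟨y, hy⟩ := hne
    obtain ⟨y', hy', -⟩ := ht y hy
    exact ⟨y', hy'⟩
  have h1 := integral_supportFn_le_integral_min_of_finite htS' htne
  have hmono : ∀ g, supportFn (t : Set H) g ≤ supportFn S g := fun g =>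
    supportFn_le htne fun w hw => inner_le_supportFn hS (htS hw) g
  have it := integrable_supportFn htS' htne
  have iS := integrable_supportFn hS hne
  have h2 : ∫ g, supportFn S g ∂(stdGaussian H) ≤
      ∫ g, supportFn (t : Set H) g ∂(stdGaussian H) + 1 := by
    calc _ ≤ ∫ g, (supportFn (t : Set H) g + 1 / (M + 1) * ‖g‖) ∂(stdGaussian H) :=
          integral_mono iS (it.add (integrable_norm_stdGaussian.const_mul _))
            fun g => supportFn_le_net hS hne htS ht g
      _ = ∫ g, supportFn (t : Set H) g ∂(stdGaussian H) + 1 / (M + 1) * M := by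
          rw [integral_add it (integrable_norm_stdGaussian.const_mul _), integral_const_mul]
      _ ≤ _ := by
          gcongr
          rw [div_mul_eq_mul_div, one_mul, div_le_one (by positivity)]
          linarith
  have h3 : ∫ q, min (supportFn (t : Set H) q.1) (supportFn (t : Set H) q.2)
      ∂((stdGaussian H).prod (stdGaussian H)) ≤
      ∫ q, min (supportFn S q.1) (supportFn S q.2) ∂((stdGaussian H).prod (stdGaussian H)) :=
    integral_mono ((it.comp_fst _).inf (it.comp_snd _)) ((iS.comp_fst _).inf (iS.comp_snd _))
      fun q => min_le_min (hmono _) (hmono _)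
  linarith

/-- Since `|a - b| = a + b - 2 * min a b`, a lower bound on the mean minimum of two independent
copies bounds their mean distance. Averaging over the second copy inside the absolute value replaces
it by its mean. -/
lemma integral_abs_supportFn_sub_le {S : Set H} (hS : S ⊆ Metric.sphere 0 1) (hne : S.Nonempty) :
    ∫ g, |supportFn S g - ∫ g', supportFn S g' ∂(stdGaussian H)| ∂(stdGaussian H) ≤
      concentrationConst := by
  set σ := supportFn S
  set w := ∫ g', σ g' ∂(stdGaussian H)
  have iS : Integrable σ (stdGaussian H) := integrable_supportFn hS hne
  have i1 : Integrable (fun q : H × H => σ q.1) ((stdGaussian H).prod (stdGaussian H)) :=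
    iS.comp_fst _
  have i2 : Integrable (fun q : H × H => σ q.2) ((stdGaussian H).prod (stdGaussian H)) :=
    iS.comp_snd _
  have im : Integrable (fun q : H × H => min (σ q.1) (σ q.2))
      ((stdGaussian H).prod (stdGaussian H)) := i1.inf i2
  have ia : Integrable (fun q : H × H => |σ q.1 - σ q.2|)
      ((stdGaussian H).prod (stdGaussian H)) := (i1.sub i2).abs
  have i12 : Integrable (fun q : H × H => σ q.1 + σ q.2)
      ((stdGaussian H).prod (stdGaussian H)) := i1.add i2
  have h1 : ∫ q : H × H, |σ q.1 - σ q.2| ∂((stdGaussian H).prod (stdGaussian H)) =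
      2 * w - 2 * ∫ q, min (σ q.1) (σ q.2) ∂((stdGaussian H).prod (stdGaussian H)) := by
    have e : ∀ q : H × H, |σ q.1 - σ q.2| = σ q.1 + σ q.2 - 2 * min (σ q.1) (σ q.2) := fun q => by
      rcases le_total (σ q.1) (σ q.2) with h | h
      · rw [min_eq_left h, abs_of_nonpos (by linarith)]; ring
      · rw [min_eq_right h, abs_of_nonneg (by linarith)]; ring
    simp only [e]
    rw [integral_sub i12 (im.const_mul _), integral_add i1 i2, integral_const_mul,
      integral_fun_fst (f := σ), integral_fun_snd (f := σ)]
    simp only [probReal_univ, one_smul]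
    ring
  have h2 := integral_supportFn_le_integral_min hS hne
  have h3 : ∫ g, |σ g - w| ∂(stdGaussian H) ≤
      ∫ q : H × H, |σ q.1 - σ q.2| ∂((stdGaussian H).prod (stdGaussian H)) := by
    rw [integral_prod _ ia]
    refine integral_mono (iS.sub (integrable_const _)).abs ia.integral_prod_left fun g => ?_
    have e : σ g - w = ∫ g', (σ g - σ g') ∂(stdGaussian H) := by
      rw [integral_sub (integrable_const _) iS]; simp [w]
    simp only
    rw [e]
    exact abs_integral_le_integral_abs
  simp only [concentrationConst]
  linarith

/-- Concentration of the support function of a subset of the sphere, uniformly in the dimension. -/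
theorem measure_le_abs_supportFn_sub {S : Set H} (hS : S ⊆ Metric.sphere 0 1) (hne : S.Nonempty)
    {t : ℝ} (ht : 0 < t) :
    stdGaussian H {g | t ≤ |supportFn S g - ∫ g', supportFn S g' ∂(stdGaussian H)|} ≤
      ENNReal.ofReal (concentrationConst / t) := by
  have iS : Integrable (supportFn S) (stdGaussian H) := integrable_supportFn hS hne
  have h := mul_meas_ge_le_integral_of_nonneg (μ := stdGaussian H)
    (f := fun g => |supportFn S g - ∫ g', supportFn S g' ∂(stdGaussian H)|)
    (Eventually.of_forall fun _ => abs_nonneg _) (iS.sub (integrable_const _)).abs t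
  have h' := h.trans (integral_abs_supportFn_sub_le hS hne)
  rw [← ofReal_measureReal]
  refine ENNReal.ofReal_le_ofReal ?_
  rwa [le_div_iff₀ ht, mul_comm]

end Concentration

/-! ### Concentration of the Gaussian norm. -/

section NormConcentration

lemma memLp_sq_gaussianReal : MemLp (fun x : ℝ => x ^ 2) 2 (gaussianReal 0 1) := by
  rw [memLp_two_iff_integrable_sq (Continuous.aestronglyMeasurable (by fun_prop))]
  have := (IsGaussian.memLp_id (gaussianReal 0 1) 4 (by norm_num)).integrable_norm_pow (by norm_num)
  refine this.congr (Eventually.of_forall fun x => ?_)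
  simp only [id, Real.norm_eq_abs]
  rw [← pow_mul]
  exact Even.pow_abs (by decide) x

lemma integral_sq_gaussianReal : ∫ x, x ^ 2 ∂(gaussianReal 0 1) = 1 := by
  have := variance_of_integral_eq_zero (X := fun r : ℝ => r) (μ := gaussianReal 0 1)
    (Measurable.aemeasurable measurable_id') (by simp)
  rw [variance_fun_id_gaussianReal] at this
  simpa using this.symm

/-- The norm of a standard Gaussian vector of `ℝᵐ` concentrates around `√m`. -/
theorem measure_le_abs_norm_sub_sqrt (m : ℕ) {t : ℝ} (ht : 0 < t) :
    stdGaussian (E m) {h | t ≤ |‖h‖ - √(m : ℝ)|} ≤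
      ENNReal.ofReal (Var[fun x : ℝ => x ^ 2; gaussianReal 0 1] / t ^ 2) := by
  rcases Nat.eq_zero_or_pos m with rfl | hm
  · have : {h : E 0 | t ≤ |‖h‖ - √((0 : ℕ) : ℝ)|} = ∅ := by
      rw [Set.eq_empty_iff_forall_notMem]
      intro h hh
      rw [Subsingleton.elim h 0] at hh
      simp at hh
      linarith
    rw [this]; simp
  have hm' : (0 : ℝ) < m := by exact_mod_cast hm
  set π : Measure (Fin m → ℝ) := Measure.pi fun _ => gaussianReal 0 1
  set X : (Fin m → ℝ) → ℝ := ∑ i, fun x : Fin m → ℝ => x i ^ 2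
  have hXv : Var[X; π] = m * Var[fun x : ℝ => x ^ 2; gaussianReal 0 1] := by
    have := variance_sum_pi (μ := fun _ : Fin m => gaussianReal 0 1)
      (X := fun _ (x : ℝ) => x ^ 2) (fun _ => memLp_sq_gaussianReal)
    rw [this]; simp
  have hev : ∀ i : Fin m, MeasurePreserving (Function.eval i) π (gaussianReal 0 1) := fun i =>
    measurePreserving_eval (fun _ : Fin m => gaussianReal 0 1) i
  have hm2 : ∀ i : Fin m, MemLp (fun x : Fin m → ℝ => x i ^ 2) 2 π := fun i =>
    memLp_sq_gaussianReal.comp_measurePreserving (hev i)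
  have hX2 : MemLp X 2 π := memLp_finsetSum' _ fun i _ => hm2 i
  have hXa : ∀ x, X x = ∑ i, x i ^ 2 := fun x => by simp [X]
  have hXm : ∫ x, X x ∂π = m := by
    simp only [hXa]
    rw [integral_finsetSum _ fun i _ => (hm2 i).integrable (by norm_num)]
    have : ∀ i : Fin m, ∫ x : Fin m → ℝ, x i ^ 2 ∂π = 1 := fun i => by
      rw [← integral_sq_gaussianReal, ← (hev i).map_eq,
        integral_map (hev i).measurable.aemeasurable (Continuous.aestronglyMeasurable (by fun_prop))]
    simp [this]
  -- Chebyshev for `‖h‖ ^ 2` at level `t * √m`: the factorization `‖h‖ ^ 2 - m = (‖h‖ - √m) * (‖h‖ +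
  -- √m)` turns a deviation `t` of the norm into at least this much, and the factor `m` in the
  -- variance cancels.
  have hc := meas_ge_le_variance_div_sq hX2 (c := t * √(m : ℝ)) (by positivity)
  rw [hXv, hXm, mul_pow, Real.sq_sqrt hm'.le] at hc
  rw [← map_pi_eq_stdGaussian, Measure.map_apply (by fun_prop) (measurableSet_le measurable_const
    (by fun_prop))]
  calc _ ≤ π {x | t * √(m : ℝ) ≤ |X x - m|} := by
        refine measure_mono fun x hx => ?_
        simp only [Set.mem_preimage, Set.mem_ofPred_eq] at hx ⊢
        have e : X x = ‖(WithLp.toLp 2 x : E m)‖ ^ 2 := by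
          rw [hXa, EuclideanSpace.real_norm_sq_eq]
        have e2 : X x - m = (‖(WithLp.toLp 2 x : E m)‖ - √(m : ℝ)) *
            (‖(WithLp.toLp 2 x : E m)‖ + √(m : ℝ)) := by
          rw [e]; nlinarith [Real.sq_sqrt hm'.le]
        rw [e2, abs_mul]
        have h3 : √(m : ℝ) ≤ |‖(WithLp.toLp 2 x : E m)‖ + √(m : ℝ)| :=
          (le_add_of_nonneg_left (norm_nonneg _)).trans (le_abs_self _)
        exact mul_le_mul hx h3 (Real.sqrt_nonneg _) (abs_nonneg _)
    _ ≤ _ := hc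
    _ = _ := by
      congr 1
      field_simp

end NormConcentration

/-! ### Gaussian matrices: moments and almost sure full rank. -/

section GaussianMatrix

variable {m n : ℕ}

instance isProbabilityMeasure_gaussianMatrix : IsProbabilityMeasure (gaussianMatrix m n) := by
  unfold gaussianMatrix; infer_instance

lemma isGaussian_pi_of_isGaussian {ι : Type*} [Fintype ι] {F : Type*} [NormedAddCommGroup F]
    [NormedSpace ℝ F] [CompleteSpace F] [SecondCountableTopology F] [MeasurableSpace F]
    [BorelSpace F] (μ : Measure F) [IsGaussian μ] :
    IsGaussian (Measure.pi fun _ : ι => μ) := by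
  have h1 : ∀ i : ι, HasGaussianLaw (Function.eval i : (ι → F) → F) (Measure.pi fun _ : ι => μ) :=
    fun i => ⟨by rw [(measurePreserving_eval (fun _ : ι => μ) i).map_eq]; infer_instance⟩
  have h2 : iIndepFun (fun (i : ι) (x : ι → F) => x i) (Measure.pi fun _ : ι => μ) :=
    iIndepFun_pi (X := fun (_ : ι) (x : F) => x) fun _ => aemeasurable_id
  have := (iIndepFun.hasGaussianLaw h1 h2).isGaussian_map
  have e : (fun ω : ι → F => fun i => Function.eval i ω) = id := rfl
  rwa [e, Measure.map_id] at this

instance isGaussian_gaussianMatrix : IsGaussian (gaussianMatrix m n) := by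
  have := isGaussian_pi_of_isGaussian (ι := Fin n) (gaussianReal 0 1)
  exact isGaussian_pi_of_isGaussian (ι := Fin m) (Measure.pi fun _ : Fin n => gaussianReal 0 1)

lemma variance_sum_mul_pi_gaussianReal (c : Fin n → ℝ) :
    Var[fun a : Fin n → ℝ => ∑ j, c j * a j; Measure.pi fun _ : Fin n => gaussianReal 0 1] =
      ∑ j, c j ^ 2 := by
  have e : (fun a : Fin n → ℝ => ∑ j, c j * a j) =
      ∑ j, fun a : Fin n → ℝ => (fun (j : Fin n) (r : ℝ) => c j * r) j (a j) := by
    ext a; simp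
  have hm : ∀ j : Fin n, MemLp ((fun (j : Fin n) (r : ℝ) => c j * r) j) 2 (gaussianReal 0 1) :=
    fun j => IsGaussian.memLp_two_id.const_mul _
  rw [e, variance_sum_pi hm]
  refine Finset.sum_congr rfl fun j _ => ?_
  rw [variance_const_mul, variance_fun_id_gaussianReal]
  simp

/-- The linear functional `∑ M i j * A i j`. -/
def entryPairing (M : Fin m → Fin n → ℝ) : StrongDual ℝ (Fin m → Fin n → ℝ) :=
  ∑ i, (∑ j, M i j • ContinuousLinearMap.proj (R := ℝ) (φ := fun _ : Fin n => ℝ) j).comp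
    (ContinuousLinearMap.proj (R := ℝ) (φ := fun _ : Fin m => Fin n → ℝ) i)

lemma entryPairing_apply (M A : Fin m → Fin n → ℝ) :
    entryPairing M A = ∑ i, ∑ j, M i j * A i j := by
  simp [entryPairing]

lemma integral_entryPairing (M : Fin m → Fin n → ℝ) :
    ∫ A, entryPairing M A ∂(gaussianMatrix m n) = 0 := by
  have h : ∀ i j, ∫ A, A i j ∂(gaussianMatrix m n) = 0 := fun i j => by
    have e : MeasurePreserving (fun A : Fin m → Fin n → ℝ => A i j) (gaussianMatrix m n)
        (gaussianReal 0 1) :=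
      (measurePreserving_eval (fun _ : Fin n => gaussianReal 0 1) j).comp
        (measurePreserving_eval (fun _ : Fin m => Measure.pi fun _ : Fin n => gaussianReal 0 1) i)
    have := integral_map (μ := gaussianMatrix m n) e.measurable.aemeasurable
      (f := fun r : ℝ => r) (by fun_prop)
    rw [e.map_eq] at this
    rw [← this]; simp
  have hi : ∀ i j, Integrable (fun A : Fin m → Fin n → ℝ => A i j) (gaussianMatrix m n) :=
    fun i j => IsGaussian.integrable_dual _
      ((ContinuousLinearMap.proj (R := ℝ) (φ := fun _ : Fin n => ℝ) j).comp
        (ContinuousLinearMap.proj (R := ℝ) (φ := fun _ : Fin m => Fin n → ℝ) i))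
  simp only [entryPairing_apply]
  rw [integral_finsetSum _ fun i _ => integrable_finsetSum _ fun j _ => (hi i j).const_mul _]
  refine Finset.sum_eq_zero fun i _ => ?_
  rw [integral_finsetSum _ fun j _ => (hi i j).const_mul _]
  refine Finset.sum_eq_zero fun j _ => ?_
  rw [integral_const_mul, h, mul_zero]

lemma integral_id_gaussianMatrix : ∫ A, A ∂(gaussianMatrix m n) = 0 := by
  classical
  have hi : Integrable (fun A : Fin m → Fin n → ℝ => A) (gaussianMatrix m n) :=
    IsGaussian.integrable_id
  have h : ∀ M : Fin m → Fin n → ℝ, entryPairing M (∫ A, A ∂(gaussianMatrix m n)) = 0 := fun M => by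
    rw [← ContinuousLinearMap.integral_comp_comm _ hi, integral_entryPairing]
  funext i j
  have := h (fun i' j' => if i' = i then if j' = j then 1 else 0 else 0)
  rw [entryPairing_apply] at this
  simpa [ite_mul] using this

lemma integral_entryPairing_sq (M : Fin m → Fin n → ℝ) :
    ∫ A, entryPairing M A ^ 2 ∂(gaussianMatrix m n) = ∑ i, ∑ j, M i j ^ 2 := by
  rw [← variance_of_integral_eq_zero (entryPairing M).continuous.aemeasurable
    (integral_entryPairing M)]
  have e1 : (entryPairing M : (Fin m → Fin n → ℝ) → ℝ) =
      ∑ i, fun A : Fin m → Fin n → ℝ => (fun a : Fin n → ℝ => ∑ j, M i j * a j) (A i) := by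
    ext A; simp [entryPairing_apply]
  have := isGaussian_pi_of_isGaussian (ι := Fin n) (gaussianReal 0 1)
  have hL : ∀ i, MemLp (fun a : Fin n → ℝ => ∑ j, M i j * a j) 2
      (Measure.pi fun _ : Fin n => gaussianReal 0 1) := fun i => by
    have := IsGaussian.memLp_dual (Measure.pi fun _ : Fin n => gaussianReal 0 1)
      (∑ j, M i j • ContinuousLinearMap.proj (R := ℝ) (φ := fun _ : Fin n => ℝ) j) 2 (by norm_num)
    convert! this using 1
    ext a; simp
  rw [e1, gaussianMatrix, variance_sum_pi hL]
  exact Finset.sum_congr rfl fun i _ => variance_sum_mul_pi_gaussianReal _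

/-- Polarization of the second-moment formula. -/
lemma integral_entryPairing_mul (M N : Fin m → Fin n → ℝ) :
    ∫ A, entryPairing M A * entryPairing N A ∂(gaussianMatrix m n) = ∑ i, ∑ j, M i j * N i j := by
  have hi : ∀ M : Fin m → Fin n → ℝ, Integrable (fun A => entryPairing M A ^ 2)
      (gaussianMatrix m n) := fun M =>
    (IsGaussian.memLp_dual (gaussianMatrix m n) (entryPairing M) 2 (by norm_num)).integrable_sq
  have e : ∀ A, entryPairing M A * entryPairing N A =
      1 / 2 * (entryPairing (M + N) A ^ 2 - entryPairing M A ^ 2 - entryPairing N A ^ 2) := by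
    intro A
    have : entryPairing (M + N) A = entryPairing M A + entryPairing N A := by
      simp [entryPairing_apply, add_mul, Finset.sum_add_distrib]
    rw [this]; ring
  simp only [e]
  have h1 : Integrable (fun A => entryPairing (M + N) A ^ 2 - entryPairing M A ^ 2)
    (gaussianMatrix m n) := (hi _).sub (hi _)
  rw [integral_const_mul, integral_sub h1 (hi _), integral_sub (hi _) (hi _),
    integral_entryPairing_sq, integral_entryPairing_sq, integral_entryPairing_sq]
  simp only [← Finset.sum_sub_distrib, Finset.mul_sum, Pi.add_apply]
  exact Finset.sum_congr rfl fun _ _ => Finset.sum_congr rfl fun _ _ => by ring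

/-- The bilinear form `νᵀ A w` as a functional of `A`. -/
def matrixForm (ν : E m) (w : E n) : StrongDual ℝ (Fin m → Fin n → ℝ) :=
  entryPairing fun i j => ν i * w j

lemma matrixForm_apply (ν : E m) (w : E n) (A : Fin m → Fin n → ℝ) :
    matrixForm ν w A = inner ℝ ν (mulMap A w) := by
  rw [matrixForm, entryPairing_apply, PiLp.inner_apply]
  refine Finset.sum_congr rfl fun i _ => ?_
  simp only [mulMap, Matrix.toLpLin_apply, Matrix.mulVec, dotProduct, Matrix.of_apply,
    RCLike.inner_apply, conj_trivial, Finset.sum_mul]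
  exact Finset.sum_congr rfl fun j _ => by ring

lemma isGaussianForm_matrixForm : IsGaussianForm (gaussianMatrix m n) matrixForm where
  gaussian := inferInstance
  centered := integral_id_gaussianMatrix
  moment x x' y y' := by
    simp only [matrixForm]
    rw [integral_entryPairing_mul, PiLp.inner_apply, PiLp.inner_apply, Finset.sum_mul_sum]
    refine Finset.sum_congr rfl fun i _ => Finset.sum_congr rfl fun j _ => ?_
    simp only [RCLike.inner_apply, conj_trivial]
    ring
  sub_left x x' y := by
    ext A; simp [matrixForm_apply, inner_sub_left]
  sub_right x y y' := by
    ext A; simp [matrixForm_apply, inner_sub_right]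
  bound := by
    refine ⟨m * n, fun x y A => ?_⟩
    rw [matrixForm, entryPairing_apply]
    have h : ∀ i j, |x i * y j * A i j| ≤ ‖A‖ * ‖x‖ * ‖y‖ := fun i j => by
      have h1 : |x i| ≤ ‖x‖ := PiLp.norm_apply_le x i
      have h2 : |y j| ≤ ‖y‖ := PiLp.norm_apply_le y j
      have h3 : |A i j| ≤ ‖A‖ := (norm_le_pi_norm (A i) j).trans (norm_le_pi_norm A i)
      rw [abs_mul, abs_mul]
      calc _ ≤ ‖x‖ * ‖y‖ * ‖A‖ := by gcongr
        _ = _ := by ring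
    calc _ ≤ ∑ i, ∑ j, |x i * y j * A i j| :=
          (Finset.abs_sum_le_sum_abs _ _).trans
            (Finset.sum_le_sum fun _ _ => Finset.abs_sum_le_sum_abs _ _)
      _ ≤ ∑ _i : Fin m, ∑ _j : Fin n, ‖A‖ * ‖x‖ * ‖y‖ :=
          Finset.sum_le_sum fun i _ => Finset.sum_le_sum fun j _ => h i j
      _ = _ := by simp; ring

/-- A standard Gaussian row avoids a given proper subspace. -/
lemma pi_gaussianReal_submodule_eq_zero (W : Submodule ℝ (Fin n → ℝ)) (hW : W ≠ ⊤) :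
    (Measure.pi fun _ : Fin n => gaussianReal 0 1) (W : Set (Fin n → ℝ)) = 0 := by
  obtain ⟨f, hf, hWf⟩ := W.exists_le_ker_of_lt_top hW.lt_top
  have := isGaussian_pi_of_isGaussian (ι := Fin n) (gaussianReal 0 1)
  set π := Measure.pi fun _ : Fin n => gaussianReal 0 1
  let L : StrongDual ℝ (Fin n → ℝ) := f.toContinuousLinearMap
  -- The variance is the sum of squared coefficients of a nonzero functional. Its law is therefore a
  -- nondegenerate Gaussian, with no atom at 0.
  have hv : Var[L; π] ≠ 0 := by
    have e : (L : (Fin n → ℝ) → ℝ) =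
        fun a : Fin n → ℝ => ∑ j, f (Pi.single j 1) * a j := by
      ext a
      simp only [L, LinearMap.coe_toContinuousLinearMap']
      conv_lhs => rw [LinearMap.pi_apply_eq_sum_univ f a]
      refine Finset.sum_congr rfl fun j _ => ?_
      rw [smul_eq_mul, mul_comm]
      congr 2
      ext k; simp [Pi.single_apply, eq_comm]
    rw [e, variance_sum_mul_pi_gaussianReal]
    intro h0
    apply hf
    apply LinearMap.pi_ext'
    intro j
    ext
    have := (Finset.sum_eq_zero_iff_of_nonneg fun j _ => by positivity).1 h0 j (Finset.mem_univ j)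
    simpa using this
  have hmap := IsGaussian.map_eq_gaussianReal (μ := π) L
  have hv' : Var[L; π].toNNReal ≠ 0 := by
    rw [Ne, Real.toNNReal_eq_zero, not_le]
    exact lt_of_le_of_ne (variance_nonneg _ _) hv.symm
  have := nullSingletonClass_gaussianReal (μ := π[L]) hv'
  refine measure_mono_null (t := L ⁻¹' {0}) (fun x hx => hWf hx) ?_
  rw [← Measure.map_apply L.continuous.measurable (measurableSet_singleton _), hmap]
  exact measure_singleton _

lemma measurableSet_linearIndependent :
    MeasurableSet {A : Fin m → Fin n → ℝ | LinearIndependent ℝ A} :=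
  isOpen_setOfPred_linearIndependent.measurableSet

/-- The rows of a Gaussian matrix are almost surely linearly independent. -/
lemma ae_linearIndependent_gaussianMatrix :
    ∀ m : ℕ, m ≤ n → ∀ᵐ A ∂(gaussianMatrix m n), LinearIndependent ℝ A := by
  intro m
  induction m with
  | zero => intro _; exact Eventually.of_forall fun A => linearIndependent_empty_type
  | succ k ih =>
    intro hk
    set r := Measure.pi fun _ : Fin n => gaussianReal 0 1
    have hmp := measurePreserving_piFinSuccAbove (fun _ : Fin (k + 1) => r) 0
    set e := MeasurableEquiv.piFinSuccAbove (fun _ : Fin (k + 1) => Fin n → ℝ) 0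
    rw [ae_iff]
    have hs : MeasurableSet {A : Fin (k + 1) → Fin n → ℝ | ¬ LinearIndependent ℝ A} :=
      measurableSet_linearIndependent.compl
    have hb : MeasurableSet (e.symm ⁻¹' {A : Fin (k + 1) → Fin n → ℝ | ¬ LinearIndependent ℝ A}) :=
      e.symm.measurable hs
    have h1 : gaussianMatrix (k + 1) n {A | ¬ LinearIndependent ℝ A} =
        (r.prod (gaussianMatrix k n))
          (e.symm ⁻¹' {A : Fin (k + 1) → Fin n → ℝ | ¬ LinearIndependent ℝ A}) :=
      (hmp.symm.measure_preimage hs.nullMeasurableSet).symm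
    -- Fix the last `k` rows, independent by induction. Dependence forces the first row into their
    -- span, a null set since its dimension is at most `k < n`.
    rw [h1, Measure.prod_apply_symm hb]
    refine (lintegral_congr_ae ?_).trans lintegral_zero
    filter_upwards [ih (by omega)] with B hB
    refine measure_mono_null (t := (Submodule.span ℝ (Set.range B) : Set (Fin n → ℝ)))
      (fun a ha => ?_) (pi_gaussianReal_submodule_eq_zero _ fun htop => ?_)
    · by_contra hna
      have e1 : e.symm (a, B) = (Fin.cons a B : Fin (k + 1) → Fin n → ℝ) := by
        simp [e, MeasurableEquiv.piFinSuccAbove]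
        rfl
      simp only [Set.mem_preimage, Set.mem_ofPred_eq, e1] at ha
      exact ha (linearIndependent_finCons.2 ⟨hB, hna⟩)
    · have h2 := finrank_range_le_card (R := ℝ) B
      rw [Set.finrank, htop, finrank_top] at h2
      simp at h2
      omega

end GaussianMatrix

/-! ### Transfer from the Gaussian null space to the Haar subspace. -/

section Haar

variable {m n : ℕ}

instance isHaarMeasure_orthogonalHaar : (orthogonalHaar n).IsHaarMeasure := by
  unfold orthogonalHaar; infer_instance

instance isProbabilityMeasure_orthogonalHaar : IsProbabilityMeasure (orthogonalHaar n) :=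
  ⟨by
    have := Measure.haarMeasure_self
      (K₀ := (⊤ : TopologicalSpace.PositiveCompacts (Matrix.orthogonalGroup (Fin n) ℝ)))
    simpa [orthogonalHaar] using this⟩

/-- A right translate of Haar measure is still left invariant, hence a multiple of it on a compact
group, and total mass forces the multiple to be 1. -/
lemma map_mul_right_orthogonalHaar (V : Matrix.orthogonalGroup (Fin n) ℝ) :
    (orthogonalHaar n).map (· * V) = orthogonalHaar n := by
  have hl : ((orthogonalHaar n).map (· * V)).IsMulLeftInvariant := ⟨fun g => by
    rw [Measure.map_map (by fun_prop) (by fun_prop)]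
    have : (fun x => g * x) ∘ (fun x => x * V) = (fun x => x * V) ∘ fun x => g * x := by
      ext1 x; simp [mul_assoc]
    rw [this, ← Measure.map_map (by fun_prop) (by fun_prop), map_mul_left_eq_self]⟩
  have hp : IsProbabilityMeasure ((orthogonalHaar n).map (· * V)) :=
    Measure.isProbabilityMeasure_map (by fun_prop)
  have h := Measure.isMulInvariant_eq_smul_of_compactSpace
    ((orthogonalHaar n).map (· * V)) (orthogonalHaar n)
  have h1 := congrArg (fun μ => μ Set.univ) h
  simp only [measure_univ, Measure.smul_apply] at h1
  rw [h]
  have : Measure.haarScalarFactor ((orthogonalHaar n).map (· * V)) (orthogonalHaar n) = 1 := by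
    rw [ENNReal.smul_def, smul_eq_mul, mul_one] at h1
    exact_mod_cast h1.symm
  rw [this, one_smul]

/-- Right multiplication is a measurable equivalence, so invariance extends to outer measures of
arbitrary sets. -/
lemma measure_preimage_mul_right_orthogonalHaar (V : Matrix.orthogonalGroup (Fin n) ℝ)
    (s : Set (Matrix.orthogonalGroup (Fin n) ℝ)) :
    orthogonalHaar n ((· * V) ⁻¹' s) = orthogonalHaar n s := by
  have : MeasurePreserving (MeasurableEquiv.mulRight V) (orthogonalHaar n) (orthogonalHaar n) :=
    ⟨(MeasurableEquiv.mulRight V).measurable, map_mul_right_orthogonalHaar V⟩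
  exact this.measure_preimage_equiv s

lemma ofLp_toEuclideanLin {k l : ℕ} (M : Matrix (Fin k) (Fin l) ℝ) (x : E l) :
    (Matrix.toEuclideanLin M x).ofLp = M.mulVec x.ofLp := rfl

/-- An orthogonal matrix as a linear isometry. -/
def orthogonalIsometry (U : Matrix.orthogonalGroup (Fin n) ℝ) : E n ≃ₗᵢ[ℝ] E n :=
  LinearIsometry.toLinearIsometryEquiv
    { toLinearMap := Matrix.toEuclideanLin (U : Matrix (Fin n) (Fin n) ℝ)
      norm_map' := fun x => by
        have h : (U : Matrix (Fin n) (Fin n) ℝ).transpose * U = 1 :=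
          (Matrix.mem_orthogonalGroup_iff' _ _).1 U.2
        rw [← sq_eq_sq₀ (norm_nonneg _) (norm_nonneg _), ← real_inner_self_eq_norm_sq,
          ← real_inner_self_eq_norm_sq, EuclideanSpace.inner_eq_star_dotProduct,
          EuclideanSpace.inner_eq_star_dotProduct]
        simp only [star_trivial, ofLp_toEuclideanLin]
        rw [Matrix.dotProduct_mulVec, Matrix.vecMul_mulVec, h, Matrix.vecMul_one] } rfl

lemma orthogonalIsometry_apply (U : Matrix.orthogonalGroup (Fin n) ℝ) (x : E n) :
    orthogonalIsometry U x = Matrix.toEuclideanLin (U : Matrix (Fin n) (Fin n) ℝ) x := rfl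

/-- The matrix `A Uᵀ`. -/
def rotateRows (U : Matrix.orthogonalGroup (Fin n) ℝ) (A : Fin m → Fin n → ℝ) :
    Fin m → Fin n → ℝ :=
  fun i => (U : Matrix (Fin n) (Fin n) ℝ).mulVec (A i)

lemma measurePreserving_mulVec_orthogonal (U : Matrix.orthogonalGroup (Fin n) ℝ) :
    MeasurePreserving (fun a : Fin n → ℝ => (U : Matrix (Fin n) (Fin n) ℝ).mulVec a)
      (Measure.pi fun _ => gaussianReal 0 1) (Measure.pi fun _ => gaussianReal 0 1) := by
  set π := Measure.pi fun _ : Fin n => gaussianReal 0 1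
  have h1 : π.map (WithLp.toLp 2) = stdGaussian (E n) := map_pi_eq_stdGaussian
  have h2 : (stdGaussian (E n)).map (WithLp.ofLp : E n → Fin n → ℝ) = π := by
    rw [← h1, Measure.map_map (by fun_prop) (by fun_prop)]
    exact Measure.map_id
  have h3 := stdGaussian_map (orthogonalIsometry U)
  have hc : Continuous (fun a : Fin n → ℝ => (U : Matrix (Fin n) (Fin n) ℝ).mulVec a) := by
    fun_prop
  refine ⟨hc.measurable, ?_⟩
  have e : (fun a : Fin n → ℝ => (U : Matrix (Fin n) (Fin n) ℝ).mulVec a) =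
      WithLp.ofLp ∘ (orthogonalIsometry U) ∘ (WithLp.toLp 2 : (Fin n → ℝ) → E n) := rfl
  have hm : Measurable (orthogonalIsometry U) := (orthogonalIsometry U).continuous.measurable
  rw [e, ← Measure.map_map (by fun_prop) (hm.comp (by fun_prop)),
    ← Measure.map_map hm (by fun_prop), h1, h3, h2]

lemma measurePreserving_rotateRows (U : Matrix.orthogonalGroup (Fin n) ℝ) :
    MeasurePreserving (rotateRows (m := m) U) (gaussianMatrix m n) (gaussianMatrix m n) :=
  measurePreserving_pi (fun _ : Fin m => Measure.pi fun _ : Fin n => gaussianReal 0 1)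
    (fun _ : Fin m => Measure.pi fun _ : Fin n => gaussianReal 0 1)
    fun _ => measurePreserving_mulVec_orthogonal U

lemma continuous_rotateRows : Continuous
    (fun q : (Fin m → Fin n → ℝ) × Matrix.orthogonalGroup (Fin n) ℝ => rotateRows q.2 q.1) := by
  unfold rotateRows
  fun_prop

lemma mem_nullSpace_iff {A : Fin m → Fin n → ℝ} {x : E n} :
    x ∈ nullSpace A ↔ ∀ i, A i ⬝ᵥ x.ofLp = 0 := by
  simp only [nullSpace, LinearMap.mem_ker, mulMap]
  constructor
  · intro h i
    have := congrArg (fun y : E m => y i) h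
    simpa [Matrix.mulVec] using this
  · intro h
    ext i
    simpa [Matrix.mulVec] using h i

lemma nullSpace_rotateRows (U : Matrix.orthogonalGroup (Fin n) ℝ) (A : Fin m → Fin n → ℝ) :
    nullSpace (rotateRows U A) =
      (nullSpace A).map (Matrix.toEuclideanLin (U : Matrix (Fin n) (Fin n) ℝ)) := by
  have key : ∀ x : E n, orthogonalIsometry U x ∈ nullSpace (rotateRows U A) ↔ x ∈ nullSpace A := by
    intro x
    rw [mem_nullSpace_iff, mem_nullSpace_iff]
    refine forall_congr' fun i => ?_
    have h : (U : Matrix (Fin n) (Fin n) ℝ).transpose * U = 1 :=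
      (Matrix.mem_orthogonalGroup_iff' _ _).1 U.2
    have e : rotateRows U A i ⬝ᵥ (orthogonalIsometry U x).ofLp = A i ⬝ᵥ x.ofLp := by
      rw [orthogonalIsometry_apply, ofLp_toEuclideanLin, rotateRows,
        Matrix.dotProduct_mulVec, Matrix.vecMul_mulVec, h, Matrix.vecMul_one]
    rw [e]
  ext y
  obtain ⟨x, rfl⟩ := (orthogonalIsometry U).surjective y
  rw [key]
  constructor
  · intro hx
    exact ⟨x, hx, rfl⟩
  · rintro ⟨x', hx', he⟩
    have : x' = x := (orthogonalIsometry U).injective he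
    exact this ▸ hx'

lemma rotatedSubspace_mul (U V : Matrix.orthogonalGroup (Fin n) ℝ) :
    rotatedSubspace m (U * V) = (rotatedSubspace m V).map
      (Matrix.toEuclideanLin (U : Matrix (Fin n) (Fin n) ℝ)) := by
  unfold rotatedSubspace
  rw [← Submodule.map_comp]
  congr 1
  ext1 x
  simp [Matrix.toLpLin_apply]

lemma finrank_nullSpace {A : Fin m → Fin n → ℝ} (hA : LinearIndependent ℝ A) :
    Module.finrank ℝ (nullSpace A) + m = n := by
  have h1 := (mulMap A).finrank_range_add_finrank_ker
  have h2 : Module.finrank ℝ (LinearMap.range (mulMap A)) = m := by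
    have : (Matrix.of A).rank = m := by
      have := (show LinearIndependent ℝ (Matrix.of A).row from hA).rank_matrix
      simpa using this
    rw [Matrix.rank_eq_finrank_range_toLin (Matrix.of A) (EuclideanSpace.basisFun (Fin m) ℝ).toBasis
      (EuclideanSpace.basisFun (Fin n) ℝ).toBasis] at this
    rw [mulMap, Matrix.toEuclideanLin_eq_toLin_orthonormal]
    exact this
  rw [h2, finrank_euclideanSpace_fin] at h1
  unfold nullSpace
  omega

lemma coordSubspace_eq_nullSpace (hmn : m ≤ n) :
    coordSubspace n m = nullSpace fun (i : Fin m) => Pi.single (Fin.castLE hmn i) (1 : ℝ) := by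
  ext x
  rw [mem_nullSpace_iff]
  simp only [single_dotProduct, one_mul]
  constructor
  · intro h i
    exact h (Fin.castLE hmn i) i.2
  · intro h j hj
    exact h ⟨j, hj⟩

lemma finrank_coordSubspace (hmn : m ≤ n) : Module.finrank ℝ (coordSubspace n m) + m = n := by
  rw [coordSubspace_eq_nullSpace hmn]
  refine finrank_nullSpace ?_
  exact (Pi.linearIndependent_single_one (Fin n) ℝ).comp _ (Fin.castLE_injective hmn)

/-- Two subspaces of equal dimension are isometric, and the isometry extends to the whole space. -/
lemma exists_rotatedSubspace_eq_nullSpace (hmn : m ≤ n) {A : Fin m → Fin n → ℝ}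
    (hA : LinearIndependent ℝ A) :
    ∃ V : Matrix.orthogonalGroup (Fin n) ℝ, rotatedSubspace m V = nullSpace A := by
  have hd : Module.finrank ℝ (coordSubspace n m) = Module.finrank ℝ (nullSpace A) := by
    have := finrank_coordSubspace hmn
    have := finrank_nullSpace hA
    omega
  let φ : coordSubspace n m ≃ₗᵢ[ℝ] nullSpace A :=
    (stdOrthonormalBasis ℝ _).repr.trans
      ((stdOrthonormalBasis ℝ (nullSpace A)).reindex (finCongr hd.symm)).repr.symm
  let L : E n →ₗᵢ[ℝ] E n := ((nullSpace A).subtypeₗᵢ.comp φ.toLinearIsometry).extend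
  have hL : ∀ s : coordSubspace n m, L s = φ s := fun s => LinearIsometry.extend_apply _ s
  let b := EuclideanSpace.basisFun (Fin n) ℝ
  let f : E n ≃ₗᵢ[ℝ] E n := L.toLinearIsometryEquiv rfl
  let M : Matrix (Fin n) (Fin n) ℝ := f.toMatrix b.toBasis b.toBasis
  have hM : Matrix.toEuclideanLin M = L.toLinearMap := by
    rw [Matrix.toEuclideanLin_eq_toLin_orthonormal, Matrix.toLin_toMatrix]
    rfl
  have hMo : M ∈ Matrix.orthogonalGroup (Fin n) ℝ := f.toMatrix_mem_unitaryGroup b b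
  refine ⟨⟨M, hMo⟩, ?_⟩
  unfold rotatedSubspace
  simp only [hM]
  ext y
  constructor
  · rintro ⟨x, hx, rfl⟩
    have := hL ⟨x, hx⟩
    simp only at this
    rw [LinearIsometry.coe_toLinearMap, this]
    exact (φ ⟨x, hx⟩).2
  · intro hy
    refine ⟨(φ.symm ⟨y, hy⟩ : coordSubspace n m), (φ.symm ⟨y, hy⟩).2, ?_⟩
    rw [LinearIsometry.coe_toLinearMap, hL]
    simp

/-- An event for the Haar-distributed subspace is at most as likely as the same event for the null
space of a Gaussian matrix, in the sense of outer measures. -/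
theorem orthogonalHaar_le_gaussianMatrix (hmn : m ≤ n) (p : Submodule ℝ (E n) → Prop) :
    orthogonalHaar n {U | p (rotatedSubspace m U)} ≤ gaussianMatrix m n {A | p (nullSpace A)} := by
  set s : Set (Fin m → Fin n → ℝ) := {A | p (nullSpace A)}
  -- The event need not be measurable. Its measurable hull has the same measure and makes Tonelli
  -- available.
  set B := toMeasurable (gaussianMatrix m n) s
  have hB : MeasurableSet B := measurableSet_toMeasurable _ _
  set D : Set ((Fin m → Fin n → ℝ) × Matrix.orthogonalGroup (Fin n) ℝ) :=
    {q | rotateRows q.2 q.1 ∈ B}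
  have hD : MeasurableSet D := continuous_rotateRows.measurable hB
  -- For fixed `A` of full rank the null space is `V` applied to the coordinate subspace, so by
  -- right invariance `U` applied to it has the law of the Haar subspace; it is also the null space
  -- of `A Uᵀ`. Integrating over `A` and swapping the integrals, rotation invariance of the Gaussian
  -- law removes `U`.
  have h1 : ∀ᵐ A ∂(gaussianMatrix m n), orthogonalHaar n {U | p (rotatedSubspace m U)} ≤
      orthogonalHaar n (Prod.mk A ⁻¹' D) := by
    filter_upwards [ae_linearIndependent_gaussianMatrix m hmn] with A hA
    obtain ⟨V, hV⟩ := exists_rotatedSubspace_eq_nullSpace hmn hA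
    rw [← measure_preimage_mul_right_orthogonalHaar V]
    refine measure_mono fun U hU => ?_
    simp only [Set.mem_preimage, Set.mem_ofPred_eq, rotatedSubspace_mul, hV,
      ← nullSpace_rotateRows] at hU
    exact subset_toMeasurable _ _ hU
  calc orthogonalHaar n {U | p (rotatedSubspace m U)}
      = ∫⁻ _, orthogonalHaar n {U | p (rotatedSubspace m U)} ∂(gaussianMatrix m n) := by simp
    _ ≤ ∫⁻ A, orthogonalHaar n (Prod.mk A ⁻¹' D) ∂(gaussianMatrix m n) := lintegral_mono_ae h1
    _ = ((gaussianMatrix m n).prod (orthogonalHaar n)) D := (Measure.prod_apply hD).symm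
    _ = ∫⁻ U, gaussianMatrix m n ((fun A => (A, U)) ⁻¹' D) ∂(orthogonalHaar n) :=
      Measure.prod_apply_symm hD
    _ = ∫⁻ _, gaussianMatrix m n B ∂(orthogonalHaar n) := by
      refine lintegral_congr fun U => ?_
      exact (measurePreserving_rotateRows U).measure_preimage hB.nullMeasurableSet
    _ = gaussianMatrix m n s := by simp [B, measure_toMeasurable]

end Haar

/-! ### Probability bounds for trapping and escape. -/

section Escape

variable {m n : ℕ}

lemma measure_preimage_neg_stdGaussian {s : Set (E n)} (hs : MeasurableSet s) :
    stdGaussian (E n) {g | -g ∈ s} = stdGaussian (E n) s := by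
  have h := stdGaussian_map (E := E n) (LinearIsometryEquiv.neg ℝ)
  have hm : Measurable (LinearIsometryEquiv.neg ℝ : E n ≃ₗᵢ[ℝ] E n) :=
    (LinearIsometryEquiv.neg ℝ : E n ≃ₗᵢ[ℝ] E n).continuous.measurable
  conv_rhs => rw [← h, Measure.map_apply hm hs]
  rfl

/-- The probability that the width or the norm deviates by `t` from its typical value. -/
def deviationBound (t : ℝ) : ℝ≥0∞ :=
  2 * (ENNReal.ofReal (concentrationConst / t) +
    ENNReal.ofReal (Var[fun x : ℝ => x ^ 2; gaussianReal 0 1] / t ^ 2))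

lemma tendsto_deviationBound : Tendsto deviationBound atTop (𝓝 0) := by
  have h1 : Tendsto (fun t : ℝ => ENNReal.ofReal (concentrationConst / t)) atTop (𝓝 0) := by
    simpa using ENNReal.tendsto_ofReal (tendsto_id.const_div_atTop concentrationConst)
  have h2 : Tendsto (fun t : ℝ => ENNReal.ofReal
      (Var[fun x : ℝ => x ^ 2; gaussianReal 0 1] / t ^ 2)) atTop (𝓝 0) := by
    simpa using ENNReal.tendsto_ofReal ((tendsto_pow_atTop (α := ℝ) two_ne_zero).const_div_atTop
      (Var[fun x : ℝ => x ^ 2; gaussianReal 0 1]))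
  have h3 := ENNReal.Tendsto.const_mul (a := 2) (h1.add h2) (Or.inr (by norm_num))
  rw [add_zero, mul_zero] at h3
  exact h3

lemma measurableSet_le_abs_supportFn_sub {S : Set (E n)} (hS : S ⊆ Metric.sphere 0 1)
    (hne : S.Nonempty) (t w : ℝ) : MeasurableSet {g : E n | t ≤ |supportFn S g - w|} := by
  have := continuous_supportFn hS hne
  exact measurableSet_le measurable_const (Continuous.measurable (by fun_prop))

lemma measurableSet_le_abs_norm_sub (t w : ℝ) : MeasurableSet {g : E n | t ≤ |‖g‖ - w|} :=
  measurableSet_le measurable_const (Continuous.measurable (by fun_prop))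

/-- If the width of `S` exceeds `√m`, it is unlikely that some `νᵀ A` is nonpositive on `S`. -/
theorem measure_exists_dual_le {S : Set (E n)} (hS : S ⊆ Metric.sphere 0 1) (hne : S.Nonempty)
    {t : ℝ} (ht : 0 < t)
    (hw : 2 + 2 * t ≤ ∫ g, supportFn S g ∂(stdGaussian (E n)) - √(m : ℝ)) :
    gaussianMatrix m n {A | ∃ ν ∈ Metric.sphere (0 : E m) 1, ∀ w ∈ S, matrixForm ν w A ≤ 0} ≤
      deviationBound t := by
  by_cases hP : (Metric.sphere (0 : E m) 1).Nonempty
  swap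
  · rw [Set.not_nonempty_iff_eq_empty] at hP
    simp [hP]
  refine (measure_exists_forall_le isGaussianForm_matrixForm subset_rfl hS hne).trans ?_
  unfold deviationBound
  refine mul_le_mul_right ?_ 2
  set w := ∫ g, supportFn S g ∂(stdGaussian (E n))
  -- The gap `2 + 2 * t` pays 2 for the minimax bound and `t` for each deviation, that of the width
  -- and that of the norm.
  have hsub : {p : E m × E n | supportFn S p.2 - supportFn (Metric.sphere (0 : E m) 1) (-p.1) ≤ 2} ⊆
      Prod.snd ⁻¹' {g | t ≤ |supportFn S g - w|} ∪ Prod.fst ⁻¹' {h | t ≤ |‖h‖ - √(m : ℝ)|} := by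
    intro p hp
    by_contra hcon
    simp only [Set.mem_union, Set.mem_preimage, Set.mem_ofPred_eq, not_or, not_le] at hcon hp
    have h1 := (abs_lt.1 hcon.1).1
    have h2 := (abs_lt.1 hcon.2).2
    have h3 := supportFn_le_norm (S := Metric.sphere (0 : E m) 1) subset_rfl hP (-p.1)
    rw [norm_neg] at h3
    linarith
  refine (measure_mono hsub).trans ((measure_union_le _ _).trans (add_le_add ?_ ?_))
  · rw [measurePreserving_snd.measure_preimage
      (measurableSet_le_abs_supportFn_sub hS hne _ _).nullMeasurableSet]
    exact measure_le_abs_supportFn_sub hS hne ht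
  · rw [measurePreserving_fst.measure_preimage
      (measurableSet_le_abs_norm_sub _ _).nullMeasurableSet]
    exact measure_le_abs_norm_sub_sqrt m ht

/-- **Escape through a mesh**: if `√m` exceeds the width of `S`, the null space of a Gaussian
`m × n` matrix is unlikely to meet `S`. -/
theorem measure_meets_le (hm : 0 < m) {S : Set (E n)} (hS : S ⊆ Metric.sphere 0 1)
    (hne : S.Nonempty) {t : ℝ} (ht : 0 < t)
    (hw : 2 + 2 * t ≤ √(m : ℝ) - ∫ g, supportFn S g ∂(stdGaussian (E n))) :
    gaussianMatrix m n {A | Meets (nullSpace A) S} ≤ deviationBound t := by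
  -- Positivity of `m` makes the dual sphere nonempty, with support function at least the norm.
  have : Nontrivial (E m) := by
    have : Nonempty (Fin m) := ⟨⟨0, hm⟩⟩
    infer_instance
  have hQ : (Metric.sphere (0 : E m) 1).Nonempty := NormedSpace.sphere_nonempty.2 zero_le_one
  have h0 : {A : Fin m → Fin n → ℝ | Meets (nullSpace A) S} ⊆
      {A | ∃ w ∈ S, ∀ ν ∈ Metric.sphere (0 : E m) 1, matrixForm ν w A ≤ 0} := by
    rintro A ⟨w, hw, hwS⟩
    refine ⟨w, hwS, fun ν _ => ?_⟩
    have : mulMap A w = 0 := hw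
    rw [matrixForm_apply, this, inner_zero_right]
  refine (measure_mono h0).trans
    ((measure_exists_forall_le isGaussianForm_matrixForm.flip hS subset_rfl hQ).trans ?_)
  unfold deviationBound
  refine mul_le_mul_right ?_ 2
  set w := ∫ g, supportFn S g ∂(stdGaussian (E n))
  have hsub : {p : E n × E m | supportFn (Metric.sphere (0 : E m) 1) p.2 - supportFn S (-p.1) ≤ 2} ⊆
      Prod.fst ⁻¹' {g | -g ∈ {g | t ≤ |supportFn S g - w|}} ∪
        Prod.snd ⁻¹' {h | t ≤ |‖h‖ - √(m : ℝ)|} := by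
    intro p hp
    by_contra hcon
    simp only [Set.mem_union, Set.mem_preimage, Set.mem_ofPred_eq, not_or, not_le] at hcon hp
    have h1 := (abs_lt.1 hcon.1).2
    have h2 := (abs_lt.1 hcon.2).1
    have h3 := norm_le_supportFn_sphere p.2
    linarith
  have hmeas := measurableSet_le_abs_supportFn_sub hS hne t w
  have hneg : MeasurableSet {g : E n | -g ∈ {g | t ≤ |supportFn S g - w|}} :=
    measurable_neg hmeas
  refine (measure_mono hsub).trans ((measure_union_le _ _).trans (add_le_add ?_ ?_))
  · rw [measurePreserving_fst.measure_preimage hneg.nullMeasurableSet,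
      measure_preimage_neg_stdGaussian hmeas]
    exact measure_le_abs_supportFn_sub hS hne ht
  · rw [measurePreserving_snd.measure_preimage
      (measurableSet_le_abs_norm_sub _ _).nullMeasurableSet]
    exact measure_le_abs_norm_sub_sqrt m ht

/-- Under minimax duality, a null space that misses a nonempty `sphereSet f` is separated from it
by a dual vector. -/
lemma exists_dual_of_not_meets {f : E n → ℝ} {A : Fin m → Fin n → ℝ} (hne : (sphereSet f).Nonempty)
    (hatt : TauAttained f A) (hdual : Duality f A ∨ SignDuality f A)
    (hmeet : ¬ Meets (nullSpace A) (sphereSet f)) :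
    ∃ ν ∈ Metric.sphere (0 : E m) 1, ∀ w ∈ sphereSet f, matrixForm ν w A ≤ 0 := by
  obtain ⟨w₀, hw₀, hmin⟩ := hatt
  have hpos : 0 < f w₀ := by
    by_contra hle
    exact hmeet ⟨w₀, hw₀.1, hw₀.2, not_lt.1 hle⟩
  have htau : 0 < tau f A := by
    have h1 : (f w₀ : EReal) ≤ tau f A := le_iInf₂ fun v hv => by exact_mod_cast hmin v hv
    exact lt_of_lt_of_le (by exact_mod_cast hpos) h1
  have hmm : 0 < maxMin f A := by
    rcases hdual with h | h
    · rwa [← h.2, ← h.1]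
    · rw [← sign_eq_one_iff, ← h.2, ← h.1, sign_eq_one_iff]
      exact htau
  obtain ⟨ν, hν⟩ := lt_iSup_iff.1 hmm
  -- On this set `f w ≤ 0`, so a positive Lagrangian must owe its sign to `νᵀ A w`.
  have hL : ∀ w ∈ sphereSet f, 0 < inner ℝ ν (mulMap A w) := by
    intro w hw
    have h1 : (0 : EReal) < (lagrangian f A w ν : EReal) :=
      lt_of_lt_of_le hν (iInf₂_le w (by simpa using hw.1))
    have h2 : 0 < f w + inner ℝ ν (mulMap A w) := by exact_mod_cast h1
    linarith [hw.2]
  have hν0 : ν ≠ 0 := by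
    rintro rfl
    obtain ⟨w, hw⟩ := hne
    simpa using hL w hw
  refine ⟨-(‖ν‖⁻¹ • ν), by simp [norm_smul, hν0], fun w hw => ?_⟩
  rw [matrixForm_apply, inner_neg_left, real_inner_smul_left]
  have := hL w hw
  have : 0 ≤ ‖ν‖⁻¹ * inner ℝ ν (mulMap A w) := by positivity
  linarith

/-- Only subadditivity is used, so the sets may be nonmeasurable; the control of the complement is
then the substantive hypothesis. -/
lemma tendsto_measure_one_of_compl {Ω : ℕ → Type*} [∀ n, MeasurableSpace (Ω n)]
    {P : ∀ n, Measure (Ω n)} [∀ n, IsProbabilityMeasure (P n)] {s : ∀ n, Set (Ω n)}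
    (h : Tendsto (fun n => P n (s n)ᶜ) atTop (𝓝 0)) :
    Tendsto (fun n => P n (s n)) atTop (𝓝 1) := by
  have h1 : Tendsto (fun n => 1 - P n (s n)ᶜ) atTop (𝓝 1) := by
    simpa using ENNReal.Tendsto.sub (tendsto_const_nhds (x := (1 : ℝ≥0∞))) h
      (Or.inl ENNReal.one_ne_top)
  refine tendsto_of_tendsto_of_tendsto_of_le_of_le h1 tendsto_const_nhds (fun n => ?_)
    fun n => prob_le_one
  rw [tsub_le_iff_right, ← measure_univ (μ := P n), ← Set.union_compl_self (s n)]
  exact measure_union_le _ _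

lemma sphereSet_subset {f : E n → ℝ} : sphereSet f ⊆ Metric.sphere 0 1 := fun w hw => by
  simpa using hw.1

lemma gaussianWidth_eq {f : E n → ℝ} :
    gaussianWidth f = ∫ g, supportFn (sphereSet f) g ∂(stdGaussian (E n)) := rfl

/-- With the convention `sSup ∅ = 0`, an empty set has width 0. -/
lemma nonempty_of_gaussianWidth_pos {f : E n → ℝ} (h : 0 < gaussianWidth f) :
    (sphereSet f).Nonempty := by
  by_contra hne
  rw [Set.not_nonempty_iff_eq_empty] at hne
  simp [gaussianWidth, widthAt, hne] at h

end Escape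

end Mesh

end

/-! ### Choice of the deviation levels and conclusion. -/

theorem theorem4 (m : ℕ → ℕ) (f : (n : ℕ) → Mesh.E n → ℝ)
    (hm : ∀ᶠ n in atTop, m n < n)
    (hprop : (fun n => (m n : ℝ)) =Θ[atTop] (fun n => (n : ℝ))) :
    -- 1) the subspace is trapped, under minimax duality and concentration of `w(f, g)`
    ((Tendsto (fun n => Mesh.gaussianMatrix (m n) n
          {A | ¬ (Mesh.TauAttained (f n) A ∧
            (Mesh.Duality (f n) A ∨ Mesh.SignDuality (f n) A))}) atTop (𝓝 0)) →
      (∀ ε : ℝ, 0 < ε → ∃ δ : ℝ, 0 < δ ∧ ∀ᶠ n in atTop,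
        stdGaussian (Mesh.E n)
            {g | ε * Mesh.gaussianWidth (f n) ≤
              |Mesh.widthAt (f n) g - Mesh.gaussianWidth (f n)|} ≤
          ENNReal.ofReal (Real.exp (-δ * Mesh.gaussianWidth (f n)))) →
      ∀ ε₁ ε₂ : ℝ, 0 < ε₁ → 0 < ε₂ →
        (∀ᶠ n : ℕ in atTop,
          (1 + ε₁) * √(m n : ℝ) + ε₂ * √(n : ℝ) ≤ Mesh.gaussianWidth (f n)) →
        Tendsto (fun n => Mesh.orthogonalHaar n
            {U | Mesh.Meets (Mesh.rotatedSubspace (m n) U) (Mesh.sphereSet (f n))}) atTop (𝓝 1) ∧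
        Tendsto (fun n => Mesh.gaussianMatrix (m n) n
            {A | Mesh.Meets (Mesh.nullSpace A) (Mesh.sphereSet (f n))}) atTop (𝓝 1)) ∧
    -- 2) the subspace escapes
    (Tendsto (fun n => √(m n : ℝ) - 1 / (4 * √(m n : ℝ)) - Mesh.gaussianWidth (f n))
        atTop atTop →
      Tendsto (fun n => Mesh.orthogonalHaar n
          {U | ¬ Mesh.Meets (Mesh.rotatedSubspace (m n) U) (Mesh.sphereSet (f n))}) atTop (𝓝 1) ∧
      Tendsto (fun n => Mesh.gaussianMatrix (m n) n
          {A | ¬ Mesh.Meets (Mesh.nullSpace A) (Mesh.sphereSet (f n))}) atTop (𝓝 1)) := by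
  -- it suffices to treat the null space and to show that complements have vanishing probability
  have reduce : ∀ p : (n : ℕ) → Submodule ℝ (Mesh.E n) → Prop,
      Tendsto (fun n => Mesh.gaussianMatrix (m n) n {A | ¬ p n (Mesh.nullSpace A)}) atTop (𝓝 0) →
      Tendsto (fun n => Mesh.orthogonalHaar n {U | p n (Mesh.rotatedSubspace (m n) U)})
          atTop (𝓝 1) ∧
        Tendsto (fun n => Mesh.gaussianMatrix (m n) n {A | p n (Mesh.nullSpace A)})
          atTop (𝓝 1) := by
    intro p hp
    refine ⟨Mesh.tendsto_measure_one_of_compl ?_, Mesh.tendsto_measure_one_of_compl hp⟩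
    refine tendsto_of_tendsto_of_tendsto_of_le_of_le' tendsto_const_nhds hp
      (Eventually.of_forall fun _ => zero_le) ?_
    filter_upwards [hm] with n hn
    exact Mesh.orthogonalHaar_le_gaussianMatrix hn.le fun Y => ¬ p n Y
  refine ⟨fun hdual _ ε₁ ε₂ hε₁ hε₂ hwidth => reduce
    (fun n Y => Mesh.Meets Y (Mesh.sphereSet (f n))) ?_, fun hgap => reduce
    (fun n Y => ¬ Mesh.Meets Y (Mesh.sphereSet (f n))) ?_⟩
  -- The level `t` solves `2 + 2 * t = ε₂ * √n`, which is at most the width minus `√m`.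
  · have hsqrt : Tendsto (fun n : ℕ => (ε₂ * √(n : ℝ) - 2) / 2) atTop atTop := by
      have h1 : Tendsto (fun n : ℕ => √(n : ℝ)) atTop atTop :=
        Real.tendsto_sqrt_atTop.comp tendsto_natCast_atTop_atTop
      exact (tendsto_atTop_add_const_right _ (-2) (h1.const_mul_atTop hε₂)).atTop_div_const
        two_pos
    have hb := hdual.add (Mesh.tendsto_deviationBound.comp hsqrt)
    rw [add_zero] at hb
    refine tendsto_of_tendsto_of_tendsto_of_le_of_le' tendsto_const_nhds hb
      (Eventually.of_forall fun _ => zero_le) ?_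
    filter_upwards [hwidth, hsqrt.eventually_gt_atTop 0] with n hw ht
    have hsm : 0 ≤ ε₁ * √(m n : ℝ) := by positivity
    have hsm' : 0 ≤ √(m n : ℝ) := Real.sqrt_nonneg _
    have hne : (Mesh.sphereSet (f n)).Nonempty :=
      Mesh.nonempty_of_gaussianWidth_pos (by linarith)
    refine (measure_mono fun A hA => ?_).trans ((measure_union_le _ _).trans
      (add_le_add le_rfl (Mesh.measure_exists_dual_le Mesh.sphereSet_subset hne ht ?_)))
    · by_cases hA' : Mesh.TauAttained (f n) A ∧
          (Mesh.Duality (f n) A ∨ Mesh.SignDuality (f n) A)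
      · exact Or.inr (Mesh.exists_dual_of_not_meets hne hA'.1 hA'.2 hA)
      · exact Or.inl hA'
    · rw [← Mesh.gaussianWidth_eq]
      linarith
  -- Here `2 + 2 * t` is exactly `√m` minus the width; it diverges because dropping the nonnegative
  -- term `1 / (4 * √m)` only enlarges the gap.
  · have ht : Tendsto (fun n => (√(m n : ℝ) - Mesh.gaussianWidth (f n) - 2) / 2) atTop atTop := by
      have h1 : Tendsto (fun n => √(m n : ℝ) - Mesh.gaussianWidth (f n)) atTop atTop := by
        refine tendsto_atTop_mono (fun n => ?_) hgap
        have : 0 ≤ 1 / (4 * √(m n : ℝ)) := by positivity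
        linarith
      exact (tendsto_atTop_add_const_right _ (-2) h1).atTop_div_const two_pos
    -- The lower half of proportionality, `n = O(m)`, rules out `m n = 0` for positive `n`.
    have hmpos : ∀ᶠ n in atTop, 0 < m n := by
      obtain ⟨C, hC⟩ := hprop.2.bound
      filter_upwards [hC, eventually_gt_atTop 0] with n hn hn0
      by_contra h0
      have h1 : m n = 0 := by omega
      have h2 : (0 : ℝ) < n := by exact_mod_cast hn0
      rw [h1] at hn
      simp at hn
      omega
    refine tendsto_of_tendsto_of_tendsto_of_le_of_le' tendsto_const_nhds
      (Mesh.tendsto_deviationBound.comp ht) (Eventually.of_forall fun _ => zero_le) ?_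
    filter_upwards [hmpos, ht.eventually_gt_atTop 0] with n hn htn
    simp only [not_not]
    by_cases hne : (Mesh.sphereSet (f n)).Nonempty
    · refine Mesh.measure_meets_le hn Mesh.sphereSet_subset hne htn ?_
      rw [← Mesh.gaussianWidth_eq]
      linarith
    · rw [Set.not_nonempty_iff_eq_empty] at hne
      simp [Mesh.Meets, hne]
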